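/- Let $I\subseteq\mathbb R$ be an interval (for example $I=\mathbb R$ or $I=[0,\infty)$). A weight on $I$ is a function $w$ that is locally integrable on $I$ and positive almost everywhere on $I$. For a nondegenerate compact interval $J\subseteq I$ write $\langle f\rangle_J=\frac1{|J|}\int_J f\,dx$, and set $$[w]_{RH_1}=\sup_{J\subseteq I}\Big\langle \frac{w}{\langle w\rangle_J}\log\frac{w}{\langle w\rangle_J}\Big\rangle_J,\qquad [w]_{A_\infty}=\sup_{J\subseteq I}\langle w\rangle_J\,e^{-\langle\log w\rangle_J},$$ the suprema being over all nondegenerate compact intervals $J\subseteq I$, with values in the extended reals. (1) There is an absolute constant $C>0$ such that for every interval $I$, every weight $w$ on $I$ and every real $Q$: if $[w]_{RH_1}=Q$, then $$[w]_{A_\infty}\le C\,\frac{e^{e^{Q+1}-1}}{e^{Q+1}} .$$ (2) This bound is sharp in $Q$: there is an absolute constant $c>0$ such that for every $Q\ge 0$ the following holds. The equation $t-\log t=Q+1$ has a smallest positive root $\gamma_-$, and the function $w(t)=\frac1{\gamma_-}\,t^{(1-\gamma_-)/\gamma_-}$ is a weight on $I=[0,\infty)$ with $$[w]_{RH_1}=Q,\qquad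 \langle w\rangle_{[0,b]}\,e^{-\langle\log w\rangle_{[0,b]}}=\gamma_-\exp\Big(\frac{1-\gamma_-}{\gamma_-}\Big)\ \text{ for every } b>0,$$ and $$[w]_{A_\infty}\ge c\,\frac{e^{e^{Q+1}-1}}{e^{Q+1}} .$$ -/

import Mathlib

open MeasureTheory

noncomputable section

/-- `w` is a weight on the interval `I`: locally integrable on `I` and positive almost everywhere
on `I`, with respect to Lebesgue measure. -/
structure IsWeightOn (I : Set ℝ) (w : ℝ → ℝ) : Prop where
  locallyIntegrableOn : LocallyIntegrableOn w I volume
  pos_ae : ∀ᵐ x ∂(volume.restrict I), 0 < w x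

/-- The average `⟨w⟩_J` of an integrable function over the interval `J = [a, b]`. -/
def intervalMean (w : ℝ → ℝ) (a b : ℝ) : ℝ :=
  ⨍ x in Set.Icc a b, w x ∂volume

/-- The average of `f` over `J = [a, b]` as an extended real number: the average of the positive
part minus the average of the negative part. It is the usual average when `f` is integrable on `J`,
it is `+∞` when only the negative part is integrable, and `-∞` when only the positive part is. -/
def extendedMean (f : ℝ → ℝ) (a b : ℝ) : EReal :=
  (((∫⁻ x in Set.Icc a b, ENNReal.ofReal (f x) ∂volume) / volume (Set.Icc a b) : ENNReal) : EReal)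
    - (((∫⁻ x in Set.Icc a b, ENNReal.ofReal (-f x) ∂volume) / volume (Set.Icc a b) : ENNReal) :
        EReal)

/-- `⟨(w / ⟨w⟩_J) log (w / ⟨w⟩_J)⟩_J` for `J = [a, b]`; it is `+∞` when `w log w` is not integrable
on `J`. -/
def entropyMean (w : ℝ → ℝ) (a b : ℝ) : EReal :=
  extendedMean (fun x => w x / intervalMean w a b * Real.log (w x / intervalMean w a b)) a b

/-- The constant `[w]_{RH_1}` of a weight on `I`: the supremum of `entropyMean` over all
nondegenerate compact intervals `J = [a, b] ⊆ I`. -/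
def rhOneConst (I : Set ℝ) (w : ℝ → ℝ) : EReal :=
  ⨆ (a : ℝ) (b : ℝ) (_ : a < b) (_ : Set.Icc a b ⊆ I), entropyMean w a b

/-- `⟨w⟩_J exp (-⟨log w⟩_J)` for `J = [a, b]`; it is `+∞` when `⟨log w⟩_J = -∞`. -/
def meanRatio (w : ℝ → ℝ) (a b : ℝ) : ENNReal :=
  ENNReal.ofReal (intervalMean w a b) * EReal.exp (-extendedMean (fun x => Real.log (w x)) a b)

/-- The constant `[w]_{A_∞}` of a weight on `I`: the supremum of `meanRatio` over all
nondegenerate compact intervals `J = [a, b] ⊆ I`. -/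
def aInftyConst (I : Set ℝ) (w : ℝ → ℝ) : ENNReal :=
  ⨆ (a : ℝ) (b : ℝ) (_ : a < b) (_ : Set.Icc a b ⊆ I), meanRatio w a b

/-- The power weight `w(t) = (1/γ) t^{(1-γ)/γ}` on `[0, ∞)`. -/
def extremalWeight (γ : ℝ) (t : ℝ) : ℝ :=
  1 / γ * t ^ ((1 - γ) / γ)

end

/-! The upper bound reduces to monotone weights and then follows from a differential inequality.
Entropy is measured by `klFun x = x log x + 1 - x`, which is nonnegative and convex, vanishes at
`1`, and has the same mean as `x log x` when `x` has mean one.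

Let `u` on `(0, 1)` be the increasing rearrangement of `w` restricted to `[a, b]`. Its entropy over
each `(0, t)` is still at most `Q`. To see this, let `α` be the mean of `u` over `(0, t)`. The
rising sun lemma gives disjoint intervals on which `w` has mean exactly `α`, with `w ≥ α` off their
union `G`, so the entropy of `w` over `G`, normalized by `α`, is at most `Q |G|`. Convexity compares
`G` with the sublevel set of `w` that corresponds to `(0, t)` (`integral_klFun_rearrangement_le`).

For monotone `u`, let `A` be the mean and `h ≤ Q` the entropy over `(0, x)`, and let `v ≥ 1` be the
ratio of `u(x+)` to `A`. The right derivative of `x log A - x h - ∫ log u` depends only on `v` and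
`h`, and an elementary inequality bounds it by `e^{Q+1} - (Q+1) - Q`. Integrating over `(0, 1)`
gives `log ⟨w⟩ - ⟨log w⟩ ≤ e^{Q+1} - (Q+1)`, which is the claim with `C = e`.

For sharpness, set `v = 1/γ` and take `w = v t^{v-1}`. Its entropy over `[0, b]` is `log v - (v-1)/v
= Q` for every `b`, no interval `[a, b]` with `a > 0` does worse, and `1/γ = e^{Q+1} e^{-γ}` differs
from `e^{Q+1}` by at most `e`. -/

/-! ### Quantile functions and the rising sun lemma -/

/-- Every probability measure on the line is the law of a nondecreasing function on `(0, 1)`. -/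
theorem exists_monotoneOn_map_eq (μ : Measure ℝ) [IsProbabilityMeasure μ] :
    ∃ u : ℝ → ℝ, MonotoneOn u (Set.Ioo 0 1) ∧
      Measure.map u (volume.restrict (Set.Ioo 0 1)) = μ := by
  set F := ProbabilityTheory.cdf μ with hF
  set S : ℝ → Set ℝ := fun t => {x | t ≤ F x} with hS
  have hne : ∀ t ∈ Set.Ioo (0 : ℝ) 1, (S t).Nonempty := by
    intro t ht
    have h := (ProbabilityTheory.tendsto_cdf_atTop μ).eventually (lt_mem_nhds ht.2)
    obtain ⟨x, hx⟩ := h.exists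
    exact ⟨x, hx.le⟩
  have hbd : ∀ t ∈ Set.Ioo (0 : ℝ) 1, BddBelow (S t) := by
    intro t ht
    have h := (ProbabilityTheory.tendsto_cdf_atBot μ).eventually (gt_mem_nhds ht.1)
    obtain ⟨x, hx⟩ := h.exists
    refine ⟨x, fun y hy => ?_⟩
    by_contra! hlt
    exact absurd (hy.trans (F.mono hlt.le)) (not_le.2 hx)
  -- The quantile function is the lower adjoint of the distribution function; right continuity of
  -- `F` makes the infimum attained.
  have key : ∀ t ∈ Set.Ioo (0 : ℝ) 1, ∀ x, sInf (S t) ≤ x ↔ t ≤ F x := by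
    intro t ht x
    refine ⟨fun h => ?_, fun h => csInf_le (hbd t ht) h⟩
    have hgt : ∀ y, x < y → t ≤ F y := by
      intro y hy
      obtain ⟨z, hz, hzy⟩ := exists_lt_of_csInf_lt (hne t ht) (h.trans_lt hy)
      exact (show t ≤ F z from hz).trans (F.mono hzy.le)
    have hc : Filter.Tendsto F (nhdsWithin x (Set.Ioi x)) (nhds (F x)) :=
      ((F.right_continuous x).mono Set.Ioi_subset_Ici_self).tendsto
    refine ge_of_tendsto hc ?_
    filter_upwards [self_mem_nhdsWithin] with y hy using hgt y hy
  have hmono : MonotoneOn (fun t => sInf (S t)) (Set.Ioo 0 1) := by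
    intro s hs t ht hst
    exact (key s hs _).2 (hst.trans ((key t ht _).1 le_rfl))
  refine ⟨_, hmono, ?_⟩
  have hae : AEMeasurable (fun t => sInf (S t)) (volume.restrict (Set.Ioo 0 1)) :=
    aemeasurable_restrict_of_monotoneOn measurableSet_Ioo hmono
  refine Measure.ext_of_Iic _ _ fun x => ?_
  rw [Measure.map_apply_of_aemeasurable hae measurableSet_Iic, Measure.restrict_apply' measurableSet_Ioo]
  have h0 := ProbabilityTheory.cdf_nonneg μ x
  have h1 := ProbabilityTheory.cdf_le_one μ x
  have hset : (fun t => sInf (S t)) ⁻¹' Set.Iic x ∩ Set.Ioo 0 1 = Set.Ioc 0 (F x) ∩ Set.Ioo 0 1 := by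
    ext t
    simp only [Set.mem_inter_iff, Set.mem_preimage, Set.mem_Iic, Set.mem_Ioc]
    constructor
    · rintro ⟨h, ht⟩
      exact ⟨⟨ht.1, (key t ht x).1 h⟩, ht⟩
    · rintro ⟨h, ht⟩
      exact ⟨(key t ht x).2 h.2, ht⟩
  rw [hset, ← ProbabilityTheory.ofReal_cdf]
  refine le_antisymm ?_ ?_
  · exact (measure_mono Set.inter_subset_left).trans (by simp [hF])
  · have hsub : Set.Ioo 0 (F x) ⊆ Set.Ioc 0 (F x) ∩ Set.Ioo 0 1 :=
      fun t ht => ⟨⟨ht.1, ht.2.le⟩, ht.1, ht.2.trans_le h1⟩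
    refine le_trans (le_of_eq ?_) (measure_mono hsub)
    simp [hF]

/-- Rising sun lemma: if `∫ f ≥ 0` over `[a, b]`, there are countably many disjoint intervals over
each of which `f` has integral zero, with `f ≥ 0` almost everywhere outside their union. -/
theorem exists_intervals_integral_eq_zero {f : ℝ → ℝ} {a b : ℝ} (hab : a ≤ b)
    (hf : IntervalIntegrable f volume a b) (h0 : 0 ≤ ∫ x in a..b, f x) :
    ∃ S : Set (ℝ × ℝ), S.Countable ∧
      (∀ p ∈ S, p.1 < p.2 ∧ a ≤ p.1 ∧ p.2 ≤ b ∧ ∫ x in p.1..p.2, f x = 0) ∧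
      S.PairwiseDisjoint (fun p => Set.Ioo p.1 p.2) ∧
      ∀ᵐ x, x ∈ Set.Ioo a b → x ∉ ⋃ p ∈ S, Set.Ioo p.1 p.2 → 0 ≤ f x := by
  set F : ℝ → ℝ := fun x => ∫ y in a..x, f y with hF
  have hFc : ContinuousOn F (Set.Icc a b) := by
    have := intervalIntegral.continuousOn_primitive_interval' hf Set.left_mem_uIcc
    rwa [Set.uIcc_of_le hab] at this
  have hFa : F a = 0 := intervalIntegral.integral_same
  have hint : ∀ x ∈ Set.Icc a b, ∀ y ∈ Set.Icc a b, ∫ z in x..y, f z = F y - F x := by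
    intro x hx y hy
    have hm : ∀ z ∈ Set.Icc a b, IntervalIntegrable f volume a z := fun z hz =>
      hf.mono_set (by rw [Set.uIcc_of_le hab, Set.uIcc_of_le hz.1]; exact Set.Icc_subset_Icc_right hz.2)
    exact (intervalIntegral.integral_interval_sub_left (hm y hy) (hm x hx)).symm
  -- the first point where `F` takes the value `F b`
  obtain ⟨τ, hτ⟩ : ∃ τ, IsLeast {x ∈ Set.Icc a b | F x = F b} τ := by
    refine IsCompact.exists_isLeast ?_ ⟨b, ⟨hab, le_rfl⟩, rfl⟩
    have : {x ∈ Set.Icc a b | F x = F b} = Set.Icc a b ∩ F ⁻¹' {F b} := rfl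
    rw [this]
    exact isCompact_Icc.of_isClosed_subset
      (hFc.preimage_isClosed_of_isClosed isClosed_Icc isClosed_singleton) Set.inter_subset_left
  obtain ⟨⟨⟨haτ, hτb⟩, hFτ⟩, hτmin⟩ := hτ
  -- Stopping at `τ` rather than `b` matters: before `τ` the primitive cannot exceed `F b`, since
  -- starting from `F a = 0 ≤ F b` it would have to cross that level earlier.
  have hbelow : ∀ x ∈ Set.Icc a τ, F x ≤ F τ := by
    intro x hx
    by_contra! hlt
    have hsub : Set.Icc a x ⊆ Set.Icc a b := Set.Icc_subset_Icc_right (hx.2.trans hτb)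
    have hmem : F b ∈ Set.Icc (F a) (F x) := ⟨by rw [hFa]; exact h0, by rw [← hFτ]; exact hlt.le⟩
    obtain ⟨z, hz, hzb⟩ := intermediate_value_Icc hx.1 (hFc.mono hsub) hmem
    have hτz := hτmin ⟨hsub hz, hzb⟩
    have : z = x := le_antisymm hz.2 (hx.2.trans hτz)
    subst this
    rw [hzb, hFτ] at hlt
    exact lt_irrefl _ hlt
  -- The shadow: points where `F` lies below an earlier value. Off `G`, `F` equals its running
  -- maximum.
  set G : Set ℝ := {x ∈ Set.Ioo a τ | ∃ y ∈ Set.Icc a x, F x < F y} with hG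
  have hFcτ : ContinuousOn F (Set.Icc a τ) := hFc.mono (Set.Icc_subset_Icc_right hτb)
  have hGsub : G ⊆ Set.Ioo a τ := fun x hx => hx.1
  have hGopen : IsOpen G := by
    rw [isOpen_iff_mem_nhds]
    rintro x ⟨hx, y, hy, hxy⟩
    have hyx : y < x := lt_of_le_of_ne hy.2 (by rintro rfl; exact lt_irrefl _ hxy)
    have hcx : ContinuousAt F x := hFcτ.continuousAt (Icc_mem_nhds hx.1 hx.2)
    filter_upwards [Ioo_mem_nhds hyx hx.2, hcx.eventually (gt_mem_nhds hxy)] with z hz hzy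
    exact ⟨⟨hy.1.trans_lt hz.1, hz.2⟩, y, ⟨hy.1, hz.1.le⟩, hzy⟩
  have hnotG : ∀ x ∈ Set.Icc a τ, x ∉ G → ∀ y ∈ Set.Icc a x, F y ≤ F x := by
    intro x hx hxG y hy
    rcases eq_or_lt_of_le hx.1 with rfl | hax
    · rw [Set.Icc_self, Set.mem_singleton_iff] at hy; rw [hy]
    rcases eq_or_lt_of_le hx.2 with rfl | hxτ
    · exact hbelow y hy
    · by_contra! h
      exact hxG ⟨⟨hax, hxτ⟩, y, hy, h⟩
  -- the component of a point of `G`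
  have hcomp : ∀ x ∈ G, ∃ p : ℝ × ℝ, x ∈ Set.Ioo p.1 p.2 ∧ Set.Ioo p.1 p.2 ⊆ G ∧ p.1 ∈ Set.Icc a τ ∧
      p.2 ∈ Set.Icc a τ ∧ p.1 ∉ G ∧ p.2 ∉ G := by
    intro x hx
    have hxI := hGsub hx
    have hA : IsCompact (Set.Icc a x \ G) := isCompact_Icc.diff hGopen
    have hB : IsCompact (Set.Icc x τ \ G) := isCompact_Icc.diff hGopen
    obtain ⟨c, ⟨hc, hcG⟩, hcmax⟩ := hA.exists_isGreatest
      ⟨a, ⟨le_rfl, hxI.1.le⟩, fun h => lt_irrefl _ (hGsub h).1⟩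
    obtain ⟨d, ⟨hd, hdG⟩, hdmin⟩ := hB.exists_isLeast
      ⟨τ, ⟨hxI.2.le, le_rfl⟩, fun h => lt_irrefl _ (hGsub h).2⟩
    have hcx : c < x := lt_of_le_of_ne hc.2 (by rintro rfl; exact hcG hx)
    have hxd : x < d := lt_of_le_of_ne hd.1 (by rintro rfl; exact hdG hx)
    refine ⟨(c, d), ⟨hcx, hxd⟩, ?_, ⟨hc.1, hc.2.trans hxI.2.le⟩, ⟨hxI.1.le.trans hd.1, hd.2⟩, hcG, hdG⟩
    rintro y ⟨hy1, hy2⟩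
    by_contra hyG
    rcases le_total y x with h | h
    · exact absurd (hcmax ⟨⟨hc.1.trans hy1.le, h⟩, hyG⟩) (not_le.2 hy1)
    · exact absurd (hdmin ⟨⟨h, hy2.le.trans hd.2⟩, hyG⟩) (not_le.2 hy2)
  set S₁ : Set (ℝ × ℝ) := {p | p.1 < p.2 ∧ Set.Ioo p.1 p.2 ⊆ G ∧ p.1 ∈ Set.Icc a τ ∧
      p.2 ∈ Set.Icc a τ ∧ p.1 ∉ G ∧ p.2 ∉ G} with hS₁
  -- `F c ≤ F d` because `d` is not in the shadow. Conversely, a maximum of `F` over `[c, z]`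
  -- attained past `c` would lie in the shadow of a still larger value, either inside `[c, z]` or
  -- before `c`; both are impossible.
  have heq : ∀ p ∈ S₁, F p.1 = F p.2 := by
    rintro ⟨c, d⟩ ⟨hcd, hsub, hc, hd, hcG, hdG⟩
    simp only at hcd hsub hc hd hcG hdG ⊢
    refine le_antisymm (hnotG d hd hdG c ⟨hc.1, hcd.le⟩) ?_
    have hin : ∀ z ∈ Set.Ioo c d, F z ≤ F c := by
      intro z hz
      have hsz : Set.Icc c z ⊆ Set.Icc a τ := Set.Icc_subset_Icc hc.1 (hz.2.le.trans hd.2)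
      obtain ⟨m, hm, hmax⟩ := isCompact_Icc.exists_isMaxOn ⟨c, le_rfl, hz.1.le⟩ (hFcτ.mono hsz)
      refine (hmax (Set.right_mem_Icc.2 hz.1.le)).trans ?_
      by_contra! hlt
      have hcm : c < m := lt_of_le_of_ne hm.1 (by rintro rfl; exact lt_irrefl _ hlt)
      obtain ⟨-, y, hy, hmy⟩ := hsub ⟨hcm, hm.2.trans_lt hz.2⟩
      rcases le_total c y with h | h
      · exact absurd (hmax ⟨h, hy.2.trans hm.2⟩) (not_le.2 hmy)
      · exact absurd (hnotG c hc hcG y ⟨hy.1, h⟩) (not_le.2 (hlt.trans hmy))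
    have hcont : ContinuousWithinAt F (Set.Ioo c d) d :=
      (hFcτ d hd).mono (Set.Ioo_subset_Icc_self.trans (Set.Icc_subset_Icc hc.1 hd.2))
    have : (nhdsWithin d (Set.Ioo c d)).NeBot := by
      rw [← mem_closure_iff_nhdsWithin_neBot, closure_Ioo hcd.ne]
      exact Set.right_mem_Icc.2 hcd.le
    refine le_of_tendsto hcont.tendsto ?_
    filter_upwards [self_mem_nhdsWithin] with z hz using hin z hz
  set S : Set (ℝ × ℝ) := S₁ ∪ {p | p = (τ, b) ∧ τ < b} with hS
  have hlt : ∀ p ∈ S, p.1 < p.2 := by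
    rintro p (hp | ⟨rfl, h⟩)
    · exact hp.1
    · exact h
  have hdisj : S.PairwiseDisjoint (fun p => Set.Ioo p.1 p.2) := by
    have h11 : ∀ p ∈ S₁, ∀ q ∈ S₁, ∀ x, x ∈ Set.Ioo p.1 p.2 → x ∈ Set.Ioo q.1 q.2 →
        p.1 ≤ q.1 ∧ q.2 ≤ p.2 := by
      rintro ⟨c, d⟩ hp ⟨c', d'⟩ hq x hx hx'
      obtain ⟨-, hsub, -, -, -, -⟩ := hq
      obtain ⟨-, -, -, -, hc, hd⟩ := hp
      simp only at hsub hc hd hx hx' ⊢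
      constructor
      · by_contra! h
        exact hc (hsub ⟨h, hx.1.trans hx'.2⟩)
      · by_contra! h
        exact hd (hsub ⟨hx'.1.trans hx.2, h⟩)
    intro p hp q hq hpq
    rw [Function.onFun, Set.disjoint_left]
    intro x hx hx'
    rcases hp with hp | ⟨rfl, -⟩ <;> rcases hq with hq | ⟨rfl, -⟩
    · have h1 := h11 p hp q hq x hx hx'
      have h2 := h11 q hq p hp x hx' hx
      exact hpq (Prod.ext (le_antisymm h1.1 h2.1) (le_antisymm h2.2 h1.2))
    · exact absurd (hx.2.trans_le hp.2.2.2.1.2) (not_lt.2 hx'.1.le)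
    · exact absurd (hx'.2.trans_le hq.2.2.2.1.2) (not_lt.2 hx.1.le)
    · exact hpq rfl
  refine ⟨S, ?_, ?_, hdisj, ?_⟩
  · exact hdisj.countable_of_isOpen (fun _ _ => isOpen_Ioo) (fun p hp => Set.nonempty_Ioo.2 (hlt p hp))
  · intro p hp
    refine ⟨hlt p hp, ?_⟩
    rcases hp with hp | ⟨rfl, h⟩
    · obtain ⟨-, -, hc, hd, -, -⟩ := id hp
      refine ⟨hc.1, hd.2.trans hτb, ?_⟩
      rw [hint _ ⟨hc.1, hc.2.trans hτb⟩ _ ⟨hd.1, hd.2.trans hτb⟩, heq p hp, sub_self]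
    · refine ⟨haτ, le_rfl, ?_⟩
      rw [hint _ ⟨haτ, hτb⟩ _ ⟨hab, le_rfl⟩, ← hFτ, sub_self]
  · filter_upwards [hf.ae_hasDerivAt_integral, Measure.ae_ne volume τ] with x hx hxτ hxI hxS
    have hxu : x ∈ Set.uIcc a b := by rw [Set.uIcc_of_le hab]; exact Set.Ioo_subset_Icc_self hxI
    have hd := hx hxu a Set.left_mem_uIcc
    have hxτ' : x < τ := by
      by_contra! h
      exact hxS (Set.mem_biUnion (Or.inr ⟨rfl, h.trans_lt hxI.2⟩ : (τ, b) ∈ S)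
        ⟨lt_of_le_of_ne h (Ne.symm hxτ), hxI.2⟩)
    have hxG : x ∉ G := by
      intro h
      obtain ⟨p, hp1, hp2⟩ := hcomp x h
      exact hxS (Set.mem_biUnion (Or.inl ⟨hp1.1.trans hp1.2, hp2⟩ : p ∈ S) hp1)
    have hle := hnotG x ⟨hxI.1.le, hxτ'.le⟩ hxG
    -- At a running maximum the slopes from the left are nonnegative, and almost everywhere they
    -- converge to `f x - 0`.
    have hs := (hasDerivWithinAt_iff_tendsto_slope' (s := Set.Iio x) (by simp)).1 hd.hasDerivWithinAt
    refine ge_of_tendsto hs ?_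
    filter_upwards [Ioo_mem_nhdsLT hxI.1] with y hy
    rw [slope_def_field]
    exact div_nonneg_of_nonpos (sub_nonpos.2 (hle y ⟨hy.1.le, hy.2.le⟩)) (sub_nonpos.2 hy.2.le)

/-! ### Convexity of the entropy function -/

theorem klFun_div_eq (x : ℝ) {α : ℝ} (hα : α ≠ 0) :
    InformationTheory.klFun (x / α) = (x * Real.log x - x * Real.log α) / α + 1 - x / α := by
  rw [InformationTheory.klFun]
  rcases eq_or_ne x 0 with rfl | hx
  · simp
  · rw [Real.log_div hx hα]; ring

theorem integrable_klFun_div {Ω : Type*} [MeasurableSpace Ω] {μ : Measure Ω} [IsFiniteMeasure μ]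
    {w : Ω → ℝ} (hw : Integrable w μ) (hwl : Integrable (fun x => w x * Real.log (w x)) μ)
    {α : ℝ} (hα : α ≠ 0) : Integrable (fun x => InformationTheory.klFun (w x / α)) μ := by
  simp only [klFun_div_eq _ hα]
  exact (((hwl.sub (hw.mul_const _)).div_const _).add (integrable_const _)).sub (hw.div_const _)

/-- `klFun` is convex and zero at `1`, so it lies below its chord from `1` to `y` between these
points. The companion lemma gives the opposite sign outside. -/
theorem klFun_chord_nonpos {x y : ℝ} (hx : 1 ≤ x) (hxy : x ≤ y) (hy : 1 < y) :
    InformationTheory.klFun x - InformationTheory.klFun y / (y - 1) * (x - 1) ≤ 0 := by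
  have h := (InformationTheory.convexOn_klFun).secant_mono (a := 1) (x := x) (y := y)
    (by simp) (by simp; linarith) (by simp; linarith)
  rcases eq_or_lt_of_le hx with rfl | hx1
  · simp [InformationTheory.klFun_one]
  · have h1 := h hx1.ne' hy.ne' hxy
    simp only [InformationTheory.klFun_one, sub_zero] at h1
    rw [div_le_iff₀ (by linarith)] at h1
    linarith

theorem klFun_chord_nonneg {x y : ℝ} (hy : 1 < y) (hx : 0 ≤ x) (hxy : x ≤ 1 ∨ y ≤ x) :
    0 ≤ InformationTheory.klFun x - InformationTheory.klFun y / (y - 1) * (x - 1) := by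
  rcases hxy with h | h
  · have h1 := InformationTheory.klFun_nonneg hx
    have h2 : 0 ≤ InformationTheory.klFun y / (y - 1) :=
      div_nonneg (InformationTheory.klFun_nonneg (by linarith)) (by linarith)
    nlinarith
  · have h1 := (InformationTheory.convexOn_klFun).secant_mono (a := 1) (x := y) (y := x)
      (by simp) (by simp; linarith) (by simp; linarith) hy.ne' (by linarith) h
    simp only [InformationTheory.klFun_one, sub_zero] at h1
    rw [le_div_iff₀ (by linarith)] at h1
    linarith

/-! ### Entropy under increasing rearrangement -/

section Rearrangement

variable {Ω : Type*} [MeasurableSpace Ω] {μ : Measure Ω} {w : Ω → ℝ} {u : ℝ → ℝ}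

theorem integrableOn_comp_of_map_eq (hw : AEMeasurable w μ) (hu : MonotoneOn u (Set.Ioo 0 1))
    (hmap : Measure.map u (volume.restrict (Set.Ioo 0 1)) = Measure.map w μ)
    {g : ℝ → ℝ} (hg : Measurable g) (hi : Integrable (fun x => g (w x)) μ) :
    IntegrableOn (fun s => g (u s)) (Set.Ioo 0 1) volume := by
  have hae := aemeasurable_restrict_of_monotoneOn (μ := volume) measurableSet_Ioo hu
  have h1 : Integrable g (Measure.map w μ) :=
    (integrable_map_measure hg.aestronglyMeasurable hw).2 hi
  rw [← hmap] at h1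
  exact (integrable_map_measure hg.aestronglyMeasurable hae).1 h1

theorem setIntegral_comp_of_map_eq (hw : AEMeasurable w μ) (hu : MonotoneOn u (Set.Ioo 0 1))
    (hmap : Measure.map u (volume.restrict (Set.Ioo 0 1)) = Measure.map w μ)
    {g : ℝ → ℝ} (hg : Measurable g) :
    ∫ s in Set.Ioo 0 1, g (u s) = ∫ x, g (w x) ∂μ := by
  have hae := aemeasurable_restrict_of_monotoneOn (μ := volume) measurableSet_Ioo hu
  rw [← integral_map hae hg.aestronglyMeasurable, hmap, integral_map hw hg.aestronglyMeasurable]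

/-- The sets `(0, t]` and `{u < u t}` may differ only where `u` equals `u t`; the condition `g (u t)
= 0` makes such ties harmless. -/
theorem intervalIntegral_comp_of_map_eq (hw : AEMeasurable w μ) (hu : MonotoneOn u (Set.Ioo 0 1))
    (hmap : Measure.map u (volume.restrict (Set.Ioo 0 1)) = Measure.map w μ)
    {g : ℝ → ℝ} (hg : Measurable g) {t : ℝ} (ht : t ∈ Set.Ioo (0 : ℝ) 1) (h0 : g (u t) = 0) :
    ∫ s in 0..t, g (u s) = ∫ x, (Set.Iio (u t)).indicator g (w x) ∂μ := by
  rw [← setIntegral_comp_of_map_eq hw hu hmap (hg.indicator measurableSet_Iio),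
    intervalIntegral.integral_of_le ht.1.le]
  have hsub : Set.Ioc 0 t ⊆ Set.Ioo 0 1 := fun s hs => ⟨hs.1, hs.2.trans_lt ht.2⟩
  trans ∫ s in Set.Ioc 0 t, (Set.Iio (u t)).indicator g (u s)
  · refine setIntegral_congr_fun measurableSet_Ioc fun s hs => ?_
    have hle := hu (hsub hs) ht hs.2
    rcases eq_or_lt_of_le hle with h | h
    · simp [h, h0]
    · simp [Set.indicator, h]
  · refine (setIntegral_eq_of_subset_of_forall_sdiff_eq_zero measurableSet_Ioo hsub ?_).symm
    rintro s ⟨hs, hs'⟩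
    have hts : t ≤ s := by
      by_contra! h
      exact hs' ⟨hs.1, h.le⟩
    have := hu ht hs hts
    simp [Set.indicator, not_lt.2 this]

/-- The entropy of the increasing rearrangement `u` of `w` over `(0, t)` is controlled by the entropy
of `w` over a set `G` with the same mean that contains almost all of `{w < α}`. -/
theorem integral_klFun_rearrangement_le [IsFiniteMeasure μ] (hw : Integrable w μ)
    (hwl : Integrable (fun x => w x * Real.log (w x)) μ) (hpos : ∀ᵐ x ∂μ, 0 < w x)
    (hu : MonotoneOn u (Set.Ioo 0 1))
    (hmap : Measure.map u (volume.restrict (Set.Ioo 0 1)) = Measure.map w μ)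
    {t : ℝ} (ht : t ∈ Set.Ioo (0 : ℝ) 1) {α Q : ℝ} (hα : 0 < α) (hQ : 0 ≤ Q)
    (hmean : ∫ s in 0..t, u s = α * t) {G : Set Ω} (hG : MeasurableSet G)
    (hG1 : ∫ x in G, w x ∂μ = α * μ.real G) (hG2 : ∀ᵐ x ∂μ, x ∉ G → α ≤ w x)
    (hG3 : ∫ x in G, InformationTheory.klFun (w x / α) ∂μ ≤ Q * μ.real G) :
    ∫ s in 0..t, InformationTheory.klFun (u s / α) ≤ Q * t := by
  have hsub : Set.Ioc 0 t ⊆ Set.Ioo 0 1 := fun s hs => ⟨hs.1, hs.2.trans_lt ht.2⟩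
  have hui : IntervalIntegrable u volume 0 t := by
    rw [intervalIntegrable_iff_integrableOn_Ioc_of_le ht.1.le]
    exact (integrableOn_comp_of_map_eq hw.aemeasurable hu hmap measurable_id hw).mono_set hsub
  have hkm : Measurable fun x : ℝ => InformationTheory.klFun (x / α) :=
    InformationTheory.measurable_klFun.comp (measurable_id.div_const α)
  have hki := integrable_klFun_div hw hwl hα.ne'
  have huk : IntervalIntegrable (fun s => InformationTheory.klFun (u s / α)) volume 0 t := by
    rw [intervalIntegrable_iff_integrableOn_Ioc_of_le ht.1.le]
    exact (integrableOn_comp_of_map_eq hw.aemeasurable hu hmap hkm hki).mono_set hsub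
  set M := u t with hM
  have hle : ∀ s ∈ Set.Ioc 0 t, u s ≤ M := fun s hs => hu (hsub hs) ht hs.2
  have hαM : α ≤ M := by
    have h := intervalIntegral.integral_mono_on_of_le_Ioo ht.1.le hui
      (intervalIntegrable_const (c := M)) fun s hs => hle s ⟨hs.1, hs.2.le⟩
    rw [hmean] at h
    simp only [intervalIntegral.integral_const, sub_zero, smul_eq_mul] at h
    nlinarith [ht.1]
  -- the comparison of measures of the two sets
  have hcmp : α * t - M * t ≤ (α - M) * μ.real G := by
    have h1 := intervalIntegral_comp_of_map_eq hw.aemeasurable hu hmap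
      (g := fun x => x - M) (by fun_prop) ht (by simp [hM])
    have hwM : Integrable (fun x => w x - M) μ := hw.sub (integrable_const _)
    -- `{w < M}` is exactly where `w - M` is negative, so it minimizes the integral of `w - M` over
    -- all sets. When `α < M` this yields `μ(G) ≤ t`.
    have h2 : ∫ x, (Set.Iio M).indicator (fun x => x - M) (w x) ∂μ
        ≤ ∫ x, G.indicator (fun x => w x - M) x ∂μ := by
      refine integral_mono ?_ (hwM.indicator hG) fun x => ?_
      · refine hwM.mono (((measurable_id.sub_const M).indicator
          measurableSet_Iio).comp_aemeasurable hw.aemeasurable).aestronglyMeasurable ?_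
        refine Filter.Eventually.of_forall fun x => ?_
        exact norm_indicator_le_norm_self (fun x => x - M) (w x)
      · simp only [Set.indicator, Set.mem_Iio]
        split_ifs <;> linarith
    rw [integral_indicator hG, integral_sub hw.integrableOn (integrable_const _), hG1, ← h1,
      intervalIntegral.integral_sub hui intervalIntegrable_const, hmean] at h2
    simp at h2
    linarith
  rcases eq_or_lt_of_le hαM with heq | hlt
  · -- here `u` is constant on `(0, t)`
    have h0 : ∫ s in Set.Ioc 0 t, (M - u s) = 0 := by
      rw [← intervalIntegral.integral_of_le ht.1.le,
        intervalIntegral.integral_sub intervalIntegrable_const hui, hmean, heq]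
      simp; ring
    have hIu : IntegrableOn (fun s => M - u s) (Set.Ioc 0 t) volume :=
      (intervalIntegrable_iff_integrableOn_Ioc_of_le ht.1.le).1
        (intervalIntegrable_const.sub hui)
    have hae := (setIntegral_eq_zero_iff_of_nonneg_ae
      ((ae_restrict_iff' measurableSet_Ioc).2 (Filter.Eventually.of_forall fun s hs =>
        sub_nonneg.2 (hle s hs))) hIu).1 h0
    have : ∫ s in 0..t, InformationTheory.klFun (u s / α) = 0 := by
      rw [intervalIntegral.integral_of_le ht.1.le]
      refine integral_eq_zero_of_ae ?_
      filter_upwards [hae] with s hs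
      have : u s = α := by simp only [Pi.zero_apply] at hs; linarith
      simp [this, div_self hα.ne', InformationTheory.klFun_one]
    rw [this]
    exact mul_nonneg hQ ht.1.le
  have hy : 1 < M / α := by rwa [one_lt_div hα]
  set m := InformationTheory.klFun (M / α) / (M / α - 1) with hm
  -- Subtracting the chord through `α` and `M` makes `g` vanish at both. The subtracted term is a
  -- multiple of `x / α - 1`, so it integrates to zero over `(0, t)` and over `G`, where the means
  -- are `α`.
  set g : ℝ → ℝ := fun x => InformationTheory.klFun (x / α) - m * (x / α - 1) with hg
  have hgm : Measurable g := hkm.sub (by fun_prop)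
  have hgM : g M = 0 := by
    have : M / α - 1 ≠ 0 := by linarith
    simp only [hg, hm]
    field_simp
    ring
  have hgi : Integrable (fun x => g (w x)) μ :=
    hki.sub (((hw.div_const α).sub (integrable_const 1)).const_mul m)
  have h1 := intervalIntegral_comp_of_map_eq hw.aemeasurable hu hmap hgm ht hgM
  -- Points of `{w < M}` outside `G` have `α ≤ w < M`, where `g ≤ 0`; points of `G` outside `{w <
  -- M}` have `w ≥ M`, where `g ≥ 0`.
  have h2 : ∫ x, (Set.Iio M).indicator g (w x) ∂μ ≤ ∫ x, G.indicator (fun x => g (w x)) x ∂μ := by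
    refine integral_mono_ae ?_ (hgi.indicator hG) ?_
    · refine hgi.mono ((hgm.indicator measurableSet_Iio).comp_aemeasurable
        hw.aemeasurable).aestronglyMeasurable ?_
      exact Filter.Eventually.of_forall fun x => norm_indicator_le_norm_self g (w x)
    · filter_upwards [hpos, hG2] with x hx hxG
      simp only [Set.indicator, Set.mem_Iio]
      split_ifs with h3 h4 h4
      · exact le_rfl
      · exact klFun_chord_nonpos ((one_le_div hα).2 (hxG h4))
          (div_le_div_of_nonneg_right h3.le hα.le) hy
      · exact klFun_chord_nonneg hy (div_nonneg hx.le hα.le)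
          (Or.inr (div_le_div_of_nonneg_right (not_lt.1 h3) hα.le))
      · exact le_rfl
  have h3 : ∫ x, G.indicator (fun x => g (w x)) x ∂μ
      = ∫ x in G, InformationTheory.klFun (w x / α) ∂μ := by
    have hi : Integrable (fun x => m * (w x / α - 1)) μ :=
      ((hw.div_const α).sub (integrable_const 1)).const_mul m
    rw [integral_indicator hG, integral_sub hki.integrableOn hi.integrableOn,
      integral_const_mul, integral_sub (hw.div_const α).integrableOn (integrable_const _),
      integral_div, hG1]
    simp
    right
    field_simp
    ring
  have h4 : ∫ s in 0..t, g (u s) = ∫ s in 0..t, InformationTheory.klFun (u s / α) := by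
    have hi : IntervalIntegrable (fun s => m * (u s / α - 1)) volume 0 t :=
      ((hui.div_const α).sub intervalIntegrable_const).const_mul m
    rw [intervalIntegral.integral_sub huk hi,
      intervalIntegral.integral_const_mul,
      intervalIntegral.integral_sub (hui.div_const α) intervalIntegrable_const,
      intervalIntegral.integral_div, hmean]
    simp
    right
    field_simp
    ring
  rw [← h4, h1]
  refine (h2.trans (h3.le.trans hG3)).trans (mul_le_mul_of_nonneg_left ?_ hQ)
  nlinarith
end Rearrangement

theorem setIntegral_biUnion_Ioo_nonneg {g : ℝ → ℝ} {a b : ℝ} (hg : IntegrableOn g (Set.Ioc a b))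
    {S : Set (ℝ × ℝ)} (hS : S.Countable) (hd : S.PairwiseDisjoint (fun p => Set.Ioo p.1 p.2))
    (hsub : ∀ p ∈ S, p.1 < p.2 ∧ a ≤ p.1 ∧ p.2 ≤ b) (h0 : ∀ p ∈ S, 0 ≤ ∫ x in p.1..p.2, g x) :
    0 ≤ ∫ x in ⋃ p ∈ S, Set.Ioo p.1 p.2, g x := by
  have : Countable S := hS
  rw [Set.biUnion_eq_iUnion, integral_iUnion (fun _ => measurableSet_Ioo)]
  · refine tsum_nonneg fun p => ?_
    have h := h0 p p.2
    rwa [intervalIntegral.integral_of_le (hsub p p.2).1.le, integral_Ioc_eq_integral_Ioo] at h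
  · intro p q hpq
    exact hd p.2 q.2 fun h => hpq (Subtype.ext h)
  · refine hg.mono_set (Set.iUnion_subset fun p x hx => ?_)
    exact ⟨(hsub p p.2).2.1.trans_lt hx.1, hx.2.le.trans (hsub p p.2).2.2⟩

/-- The rising sun lemma applied to `w - α`. All the intervals it produces have the same mean `α`,
so their entropy bounds share one normalization and can be added. -/
theorem exists_measurableSet_mean_eq {w : ℝ → ℝ} {a b α Q : ℝ} (hab : a < b)
    (hw : IntegrableOn w (Set.Ioc a b))
    (hwl : IntegrableOn (fun x => w x * Real.log (w x)) (Set.Ioc a b)) (hα : 0 < α)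
    (hmean : α * (b - a) ≤ ∫ x in a..b, w x)
    (hent : ∀ c d, a ≤ c → c < d → d ≤ b →
      ∫ x in c..d, InformationTheory.klFun (w x / ((∫ y in c..d, w y) / (d - c))) ≤ Q * (d - c)) :
    ∃ G : Set ℝ, MeasurableSet G ∧ G ⊆ Set.Ioc a b ∧ ∫ x in G, w x = α * volume.real G ∧
      (∀ᵐ x, x ∈ Set.Ioc a b → x ∉ G → α ≤ w x) ∧
      ∫ x in G, InformationTheory.klFun (w x / α) ≤ Q * volume.real G := by
  have hwI : IntervalIntegrable w volume a b :=
    (intervalIntegrable_iff_integrableOn_Ioc_of_le hab.le).2 hw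
  obtain ⟨S, hS, hSp, hd, hae⟩ := exists_intervals_integral_eq_zero (f := fun x => w x - α) hab.le
    (hwI.sub intervalIntegrable_const) (by
      rw [intervalIntegral.integral_sub hwI intervalIntegrable_const]
      simp
      linarith)
  have hsub : ∀ p ∈ S, p.1 < p.2 ∧ a ≤ p.1 ∧ p.2 ≤ b := fun p hp =>
    ⟨(hSp p hp).1, (hSp p hp).2.1, (hSp p hp).2.2.1⟩
  set G : Set ℝ := ⋃ p ∈ S, Set.Ioo p.1 p.2 with hG
  have hGab : G ⊆ Set.Ioc a b := by
    refine Set.iUnion₂_subset fun p hp x hx => ?_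
    exact ⟨(hsub p hp).2.1.trans_lt hx.1, hx.2.le.trans (hsub p hp).2.2⟩
  have hfin : volume G ≠ ⊤ := ((measure_mono hGab).trans_lt (by simp)).ne
  have hcG : ∀ c : ℝ, IntegrableOn (fun _ => c) G volume := fun c => integrableOn_const hfin
  have hki : IntegrableOn (fun x => InformationTheory.klFun (w x / α)) (Set.Ioc a b) :=
    integrable_klFun_div hw hwl hα.ne'
  have hsubI : ∀ p ∈ S, IntervalIntegrable w volume p.1 p.2 := fun p hp =>
    (intervalIntegrable_iff_integrableOn_Ioc_of_le (hsub p hp).1.le).2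
      (hw.mono_set (Set.Ioc_subset_Ioc (hsub p hp).2.1 (hsub p hp).2.2))
  have hsubK : ∀ p ∈ S, IntervalIntegrable (fun x => InformationTheory.klFun (w x / α))
      volume p.1 p.2 := fun p hp =>
    (intervalIntegrable_iff_integrableOn_Ioc_of_le (hsub p hp).1.le).2
      (hki.mono_set (Set.Ioc_subset_Ioc (hsub p hp).2.1 (hsub p hp).2.2))
  have hcab : ∀ c : ℝ, IntegrableOn (fun _ => c) (Set.Ioc a b) volume :=
    fun c => integrableOn_const (by simp)
  refine ⟨G, (isOpen_biUnion fun _ _ => isOpen_Ioo).measurableSet, hGab, ?_, ?_, ?_⟩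
  -- The nonnegativity lemma for `w - α` and for its negative gives the equality.
  · have h1 := setIntegral_biUnion_Ioo_nonneg (hw.sub (hcab α)) hS hd hsub
      fun p hp => (hSp p hp).2.2.2.ge
    have h2 := setIntegral_biUnion_Ioo_nonneg (hw.sub (hcab α)).neg hS hd hsub fun p hp => by
        have := (hSp p hp).2.2.2
        simp only [Pi.neg_apply, Pi.sub_apply, intervalIntegral.integral_neg, this, neg_zero, le_refl]
    simp only [Pi.neg_apply, Pi.sub_apply, integral_neg] at h1 h2
    rw [← hG, integral_sub (hw.mono_set hGab) (hcG α)] at h1 h2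
    simp only [integral_const, smul_eq_mul, measureReal_restrict_apply_univ] at h1 h2
    linarith
  · filter_upwards [hae, Measure.ae_ne volume b] with x hx hxb hxI hxG
    have := hx ⟨hxI.1, lt_of_le_of_ne hxI.2 hxb⟩ hxG
    linarith
  · have h1 := setIntegral_biUnion_Ioo_nonneg ((hcab Q).sub hki) hS hd hsub fun p hp => by
      have h0 := (hSp p hp).2.2.2
      rw [intervalIntegral.integral_sub (hsubI p hp) intervalIntegrable_const,
        intervalIntegral.integral_const, smul_eq_mul] at h0
      have hlt := (hsub p hp).1
      have h2 := hent p.1 p.2 (hsub p hp).2.1 hlt (hsub p hp).2.2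
      have h3 : (∫ y in p.1..p.2, w y) / (p.2 - p.1) = α := by
        rw [div_eq_iff (by linarith)]
        linarith
      rw [h3] at h2
      simp only [Pi.sub_apply]
      rw [intervalIntegral.integral_sub intervalIntegrable_const (hsubK p hp),
        intervalIntegral.integral_const, smul_eq_mul]
      linarith
    simp only [Pi.sub_apply] at h1
    rw [← hG, integral_sub (hcG Q) (hki.mono_set hGab)] at h1
    simp only [integral_const, smul_eq_mul, measureReal_restrict_apply_univ] at h1
    linarith

/-! ### The differential inequality for monotone functions -/

/-- With `z = v e^{-(Q+1)}` the expression equals `v (log z + 1/z - 1) + log z + 2`. The bracket is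
nonnegative and `v ≥ 1`, so it is at least `2 log z + 1/z + 1`, whose minimum, at `z = 1/2`, is `3 -
2 log 2 > 0`. -/
theorem exp_sub_linear_bound {v : ℝ} (hv : 1 ≤ v) (Q : ℝ) :
    0 ≤ v * Real.log v + Real.log v - 2 * v + 2 - v * Q + (Real.exp (Q + 1) - (Q + 1)) := by
  have hv0 : 0 < v := by linarith
  -- `z = v e^{-(Q+1)}`
  set z := v * Real.exp (-(Q + 1)) with hz
  have hz0 : 0 < z := by positivity
  have hlz : Real.log z = Real.log v - (Q + 1) := by
    rw [hz, Real.log_mul hv0.ne' (Real.exp_pos _).ne', Real.log_exp]; ring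
  have hvz : v * z⁻¹ = Real.exp (Q + 1) := by
    rw [hz, Real.exp_neg]
    field_simp
  have h1 : 0 ≤ Real.log z + z⁻¹ - 1 := by
    have := Real.one_sub_inv_le_log_of_pos hz0
    linarith
  have h2 : 1 - (2 * z)⁻¹ ≤ Real.log 2 + Real.log z := by
    rw [← Real.log_mul two_ne_zero hz0.ne']
    exact Real.one_sub_inv_le_log_of_pos (by positivity)
  have h4 : (2 * z)⁻¹ = z⁻¹ / 2 := by field_simp
  have h5 : Real.log z + z⁻¹ - 1 ≤ v * (Real.log z + z⁻¹ - 1) := le_mul_of_one_le_left h1 hv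
  rw [← hvz]
  have h6 : v * (Real.log z + z⁻¹ - 1) = v * Real.log v - v * (Q + 1) + v * z⁻¹ - v := by
    rw [hlz]; ring
  have h7 := Real.log_two_lt_d9
  linarith

section Monotone

variable {u : ℝ → ℝ}

theorem intervalIntegrable_of_integrableOn_unit {g : ℝ → ℝ} (hg : IntegrableOn g (Set.Ioo 0 1))
    {s t : ℝ} (hs : s ∈ Set.Icc (0 : ℝ) 1) (ht : t ∈ Set.Icc (0 : ℝ) 1) :
    IntervalIntegrable g volume s t := by
  have h : IntervalIntegrable g volume 0 1 :=
    (intervalIntegrable_iff_integrableOn_Ioo_of_le zero_le_one).2 hg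
  refine h.mono_set ?_
  rw [Set.uIcc_of_le zero_le_one]
  exact Set.uIcc_subset_Icc hs ht

theorem mean_le_of_monotoneOn (hu : MonotoneOn u (Set.Ioo 0 1))
    (hui : IntegrableOn u (Set.Ioo 0 1)) {t : ℝ} (ht : t ∈ Set.Ioo (0 : ℝ) 1) :
    ∫ s in 0..t, u s ≤ t * u t := by
  have h := intervalIntegral.integral_mono_on_of_le_Ioo (μ := volume) ht.1.le
    (intervalIntegrable_of_integrableOn_unit hui (by simp) (Set.Ioo_subset_Icc_self ht))
    (intervalIntegrable_const (c := u t)) fun s hs => hu ⟨hs.1, hs.2.trans ht.2⟩ ht hs.2.le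
  simpa using h

theorem mean_le_mean_of_monotoneOn (hu : MonotoneOn u (Set.Ioo 0 1))
    (hui : IntegrableOn u (Set.Ioo 0 1)) {t : ℝ} (ht : t ∈ Set.Ioo (0 : ℝ) 1) :
    (∫ s in 0..t, u s) / t ≤ ∫ s in 0..1, u s := by
  have h0 := mean_le_of_monotoneOn hu hui ht
  have ht' := Set.Ioo_subset_Icc_self ht
  have hi1 := intervalIntegrable_of_integrableOn_unit hui (s := 0) (by simp) ht'
  have hi2 := intervalIntegrable_of_integrableOn_unit hui ht' (t := 1) (by simp)
  have h := intervalIntegral.integral_mono_on_of_le_Ioo (μ := volume) ht.2.le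
    (intervalIntegrable_const (c := u t)) hi2
    fun s hs => hu ht ⟨ht.1.trans hs.1, hs.2⟩ hs.1.le
  rw [← intervalIntegral.integral_add_adjacent_intervals hi1 hi2]
  simp only [intervalIntegral.integral_const, smul_eq_mul] at h
  rw [div_le_iff₀ ht.1]
  nlinarith [ht.1, ht.2]

theorem tendsto_right_of_monotoneOn (hu : MonotoneOn u (Set.Ioo 0 1)) {t : ℝ}
    (ht : t ∈ Set.Ioo (0 : ℝ) 1) :
    u t ≤ sInf (u '' Set.Ioo t 1) ∧
      Filter.Tendsto u (nhdsWithin t (Set.Ioi t)) (nhds (sInf (u '' Set.Ioo t 1))) := by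
  have hne : (Set.Ioo t 1).Nonempty := Set.nonempty_Ioo.2 ht.2
  have hlb : ∀ y ∈ u '' Set.Ioo t 1, u t ≤ y := by
    rintro _ ⟨s, hs, rfl⟩
    exact hu ht ⟨ht.1.trans hs.1, hs.2⟩ hs.1.le
  exact ⟨le_csInf (hne.image u) hlb,
    (hu.mono (Set.Ioo_subset_Ioo_left ht.1.le)).tendsto_nhdsWithin_Ioo_right hne ⟨_, hlb⟩⟩

/-- A monotone `u` may jump, but it has right limits everywhere, and right derivatives suffice to
show that a continuous function does not increase. -/
theorem hasDerivWithinAt_integral_comp (hu : MonotoneOn u (Set.Ioo 0 1)) {g : ℝ → ℝ}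
    (hgm : Measurable g) {a t r : ℝ} (ht : t ∈ Set.Ioo (0 : ℝ) 1)
    (hi : IntervalIntegrable (fun s => g (u s)) volume a t)
    (hr : Filter.Tendsto u (nhdsWithin t (Set.Ioi t)) (nhds r)) (hg : ContinuousAt g r) :
    HasDerivWithinAt (fun x => ∫ s in a..x, g (u s)) (g r) (Set.Ici t) t := by
  refine intervalIntegral.integral_hasDerivWithinAt_of_tendsto_ae_right (t := Set.Ioi t) hi ?_ ?_
  · refine ⟨Set.Ioo t 1, Ioo_mem_nhdsGT ht.2, ?_⟩
    have := aemeasurable_restrict_of_monotoneOn (μ := volume) measurableSet_Ioo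
      (hu.mono (Set.Ioo_subset_Ioo_left ht.1.le))
    exact (hgm.comp_aemeasurable this).aestronglyMeasurable
  · exact (hg.tendsto.comp hr).mono_left inf_le_left

/-- A nondecreasing function whose entropy over each `(0, t)` is at most `Q` satisfies a lower bound
on the integral of its logarithm. -/
theorem neg_integral_log_le_of_entropy_le {Q : ℝ} (hu : MonotoneOn u (Set.Ioo 0 1))
    (hpos : ∀ s ∈ Set.Ioo (0 : ℝ) 1, 0 < u s) (hui : IntegrableOn u (Set.Ioo 0 1))
    (hul : IntegrableOn (fun s => u s * Real.log (u s)) (Set.Ioo 0 1))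
    (hent : ∀ t ∈ Set.Ioo (0 : ℝ) 1,
      ∫ s in 0..t, InformationTheory.klFun (u s / ((∫ y in 0..t, u y) / t)) ≤ Q * t)
    {ε t : ℝ} (hε : 0 < ε) (hεt : ε ≤ t) (ht : t < 1) :
    - ∫ s in ε..t, Real.log (u s) ≤ (Real.exp (Q + 1) - (Q + 1)) * t
      - t * Real.log ((∫ s in 0..t, u s) / t)
      + ε * (Real.log (∫ s in 0..1, u s) - (Real.exp (Q + 1) - (Q + 1) - Q)) := by
  set κ := Real.exp (Q + 1) - (Q + 1) with hκ
  set U : ℝ → ℝ := fun x => ∫ s in 0..x, u s with hU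
  set E : ℝ → ℝ := fun x => ∫ s in 0..x, u s * Real.log (u s) with hE
  have hI : ∀ x ∈ Set.Icc ε t, x ∈ Set.Ioo (0 : ℝ) 1 := fun x hx =>
    ⟨hε.trans_le hx.1, hx.2.trans_lt ht⟩
  have hUi : ∀ x ∈ Set.Ioo (0 : ℝ) 1, IntervalIntegrable u volume 0 x := fun x hx =>
    intervalIntegrable_of_integrableOn_unit hui (by simp) (Set.Ioo_subset_Icc_self hx)
  have hEi : ∀ x ∈ Set.Ioo (0 : ℝ) 1,
      IntervalIntegrable (fun s => u s * Real.log (u s)) volume 0 x := fun x hx =>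
    intervalIntegrable_of_integrableOn_unit hul (by simp) (Set.Ioo_subset_Icc_self hx)
  have hUpos : ∀ x ∈ Set.Ioo (0 : ℝ) 1, 0 < U x := fun x hx =>
    intervalIntegral.intervalIntegral_pos_of_pos_on (hUi x hx)
      (fun s hs => hpos s ⟨hs.1, hs.2.trans hx.2⟩) hx.1
  -- the entropy on `(0, x)`
  have hH : ∀ x ∈ Set.Ioo (0 : ℝ) 1,
      0 ≤ E x / U x - Real.log (U x / x) ∧ E x / U x - Real.log (U x / x) ≤ Q := by
    intro x hx
    have hU0 := hUpos x hx
    have hα : U x / x ≠ 0 := (div_pos hU0 hx.1).ne'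
    have heq : ∫ s in 0..x, InformationTheory.klFun (u s / (U x / x))
        = x * (E x / U x - Real.log (U x / x)) := by
      simp only [klFun_div_eq _ hα]
      rw [intervalIntegral.integral_sub ((((hEi x hx).sub ((hUi x hx).mul_const _)).div_const _).add
        intervalIntegrable_const) ((hUi x hx).div_const _),
        intervalIntegral.integral_add (((hEi x hx).sub ((hUi x hx).mul_const _)).div_const _)
        intervalIntegrable_const, intervalIntegral.integral_div, intervalIntegral.integral_div,
        intervalIntegral.integral_sub (hEi x hx) ((hUi x hx).mul_const _),
        intervalIntegral.integral_mul_const]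
      change (E x - U x * Real.log (U x / x)) / (U x / x) + _ - U x / (U x / x) = _
      have hx0 := hx.1.ne'
      have := hU0.ne'
      simp only [intervalIntegral.integral_const, smul_eq_mul]
      field_simp
      ring
    have h1 := hent x hx
    rw [heq] at h1
    have h2 : 0 ≤ x * (E x / U x - Real.log (U x / x)) := by
      rw [← heq]
      refine intervalIntegral.integral_nonneg_of_ae_restrict hx.1.le ?_
      refine (ae_restrict_iff' measurableSet_Icc).2 ?_
      filter_upwards [Measure.ae_ne volume 0] with s hs0 hs
      exact InformationTheory.klFun_nonneg (div_nonneg (hpos s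
        ⟨lt_of_le_of_ne hs.1 (Ne.symm hs0), hs.2.trans_lt hx.2⟩).le (div_pos hU0 hx.1).le)
    exact ⟨nonneg_of_mul_nonneg_right h2 hx.1, le_of_mul_le_mul_left (by linarith) hx.1⟩
  have hlogi : ∀ x ∈ Set.Icc ε t, IntervalIntegrable (fun s => Real.log (u s)) volume ε x := by
    intro x hx
    refine MonotoneOn.intervalIntegrable ?_
    rw [Set.uIcc_of_le hx.1]
    intro y hy z hz hyz
    have hy' := hI y ⟨hy.1, hy.2.trans hx.2⟩
    exact Real.log_le_log (hpos y hy') (hu hy' (hI z ⟨hz.1, hz.2.trans hx.2⟩) hyz)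
  -- With `A = U x / x` and entropy `h = E x / U x - log A`, this is `x log A - x h - ∫ log u - (κ -
  -- Q) x`. It is shown to be nonincreasing; comparing its values at `ε` and `t`, with `h ≥ 0` at
  -- `ε` and `h ≤ Q` at `t`, gives the bound.
  set X : ℝ → ℝ := fun x => 2 * (x * Real.log (U x / x)) - x * (E x / U x)
    - (∫ s in ε..x, Real.log (u s)) - (κ - Q) * x with hX
  have hsubI : Set.Icc ε t ⊆ Set.Icc 0 t := Set.Icc_subset_Icc_left hε.le
  have ht' : t ∈ Set.Ioo (0 : ℝ) 1 := ⟨hε.trans_le hεt, ht⟩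
  have hcU : ContinuousOn U (Set.Icc ε t) := by
    have := intervalIntegral.continuousOn_primitive_interval' (hUi t ht') Set.left_mem_uIcc
    rw [Set.uIcc_of_le ht'.1.le] at this
    exact this.mono hsubI
  have hcE : ContinuousOn E (Set.Icc ε t) := by
    have := intervalIntegral.continuousOn_primitive_interval' (hEi t ht') Set.left_mem_uIcc
    rw [Set.uIcc_of_le ht'.1.le] at this
    exact this.mono hsubI
  have hcL : ContinuousOn (fun x => ∫ s in ε..x, Real.log (u s)) (Set.Icc ε t) := by
    have := intervalIntegral.continuousOn_primitive_interval' (hlogi t ⟨hεt, le_rfl⟩)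
      Set.left_mem_uIcc
    rwa [Set.uIcc_of_le hεt] at this
  have hcX : ContinuousOn X (Set.Icc ε t) := by
    have hne : ∀ x ∈ Set.Icc ε t, U x / x ≠ 0 := fun x hx =>
      (div_pos (hUpos x (hI x hx)) (hI x hx).1).ne'
    have hd : ContinuousOn (fun x => U x / x) (Set.Icc ε t) :=
      hcU.div continuousOn_id fun x hx => (hI x hx).1.ne'
    exact (((continuousOn_const.mul (continuousOn_id.mul (hd.log hne))).sub
      (continuousOn_id.mul (hcE.div hcU fun x hx => (hUpos x (hI x hx)).ne'))).sub hcL).sub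
      (continuousOn_const.mul continuousOn_id)
  have hderiv : ∀ x ∈ Set.Ico ε t, ∃ d ≤ 0, HasDerivWithinAt X d (Set.Ici x) x := by
    intro x hx
    have hx' := hI x (Set.Ico_subset_Icc_self hx)
    obtain ⟨hr1, hr2⟩ := tendsto_right_of_monotoneOn hu hx'
    set r := sInf (u '' Set.Ioo x 1) with hr
    have hr0 : 0 < r := (hpos x hx').trans_le hr1
    have hU0 := hUpos x hx'
    have hx0 := hx'.1
    have dU : HasDerivWithinAt U r (Set.Ici x) x :=
      hasDerivWithinAt_integral_comp hu measurable_id hx' (hUi x hx') hr2 continuousAt_id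
    have dE : HasDerivWithinAt E (r * Real.log r) (Set.Ici x) x :=
      hasDerivWithinAt_integral_comp hu (g := fun y => y * Real.log y)
        (measurable_id.mul Real.measurable_log) hx' (hEi x hx') hr2
        (Real.continuous_mul_log.continuousAt)
    have dL : HasDerivWithinAt (fun x => ∫ s in ε..x, Real.log (u s)) (Real.log r) (Set.Ici x) x :=
      hasDerivWithinAt_integral_comp hu Real.measurable_log hx'
        (hlogi x (Set.Ico_subset_Icc_self hx)) hr2 (Real.continuousAt_log hr0.ne')
    have did := hasDerivWithinAt_id x (Set.Ici x)
    have dA := (dU.fun_div did hx0.ne').log (div_pos hU0 hx0).ne'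
    have dX := ((((did.fun_mul dA).const_mul 2).sub
      (did.fun_mul (dE.fun_div dU hU0.ne'))).sub dL).sub (did.const_mul (κ - Q))
    refine ⟨_, ?_, dX⟩
    obtain ⟨-, hHQ⟩ := hH x hx'
    set A := U x / x with hA
    set v := r / A with hv
    have hA0 : 0 < A := div_pos hU0 hx0
    have hv1 : 1 ≤ v := by
      rw [hv, one_le_div hA0, hA, div_le_iff₀ hx0, mul_comm]
      exact (mean_le_of_monotoneOn hu hui hx').trans (mul_le_mul_of_nonneg_left hr1 hx0.le)
    have hkey := exp_sub_linear_bound hv1 Q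
    have hr' : r = v * A := by rw [hv]; field_simp
    have hUx : U x = A * x := by rw [hA]; field_simp
    have hlr : Real.log r = Real.log v + Real.log A := by
      rw [hr', Real.log_mul (by positivity) hA0.ne']
    set h := E x / U x - Real.log A with hh
    have hEx : E x = (h + Real.log A) * (A * x) := by rw [hh, ← hUx]; field_simp; ring
    have hid : 2 * (1 * Real.log A + x * ((r * x - U x * 1) / x ^ 2 / A))
        - (1 * (E x / U x) + x * ((r * Real.log r * U x - E x * r) / U x ^ 2)) - Real.log r
        - (κ - Q) * 1
        = -(v * Real.log v + Real.log v - 2 * v + 2 + (1 - v) * h + (κ - Q)) := by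
      rw [hlr, hEx, hUx, hr']
      field_simp
      ring
    simp only [id]
    -- Since `v ≥ 1` and `h ≤ Q`, `(1 - v) h ≥ (1 - v) Q`; what remains is `hkey`.
    refine le_trans (le_of_eq hid) ?_
    nlinarith
  choose! d hd0 hd using hderiv
  have hle := image_le_of_deriv_right_le_deriv_boundary hcX hd (B := fun _ => X ε)
    (B' := fun _ => 0) le_rfl continuousOn_const (fun x _ => hasDerivWithinAt_const _ _ _) hd0
    ⟨hεt, le_rfl⟩
  have hε' := hI ε ⟨le_rfl, hεt⟩
  have h1 := (hH ε hε').1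
  have h2 := (hH t ht').2
  have h3 : Real.log (U ε / ε) ≤ Real.log (∫ s in 0..1, u s) :=
    Real.log_le_log (div_pos (hUpos ε hε') hε) (mean_le_mean_of_monotoneOn hu hui hε')
  have h4 := mul_le_mul_of_nonneg_left h1 hε.le
  have h5 := mul_le_mul_of_nonneg_left h2 ht'.1.le
  have h6 := mul_le_mul_of_nonneg_left h3 hε.le
  simp only [hX, intervalIntegral.integral_same] at hle
  change -∫ s in ε..t, Real.log (u s) ≤ κ * t - t * Real.log (U t / t) + _
  linarith

end Monotone

/-- Limit of the previous bound over `(ε, 1 - ε)` as `ε → 0`. Integrability of `log u` is not known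
beforehand; the integrand `x - 1 - log x ≥ 0` lets bounded truncated integrals imply it. -/
theorem integral_sub_log_le_of_entropy_le {u : ℝ → ℝ} {Q : ℝ} (hu : MonotoneOn u (Set.Ioo 0 1))
    (hpos : ∀ s ∈ Set.Ioo (0 : ℝ) 1, 0 < u s) (hui : IntegrableOn u (Set.Ioo 0 1))
    (hul : IntegrableOn (fun s => u s * Real.log (u s)) (Set.Ioo 0 1))
    (hent : ∀ t ∈ Set.Ioo (0 : ℝ) 1,
      ∫ s in 0..t, InformationTheory.klFun (u s / ((∫ y in 0..t, u y) / t)) ≤ Q * t)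
    {m : ℝ} (hm : ∫ s in 0..1, u s = m) :
    IntegrableOn (fun s => u s / m - 1 - Real.log (u s / m)) (Set.Ioo 0 1) ∧
      ∫ s in Set.Ioo 0 1, (u s / m - 1 - Real.log (u s / m)) ≤ Real.exp (Q + 1) - (Q + 1) := by
  set κ := Real.exp (Q + 1) - (Q + 1) with hκ
  have hI01 : IntervalIntegrable u volume 0 1 :=
    intervalIntegrable_of_integrableOn_unit hui (by simp) (by simp)
  have hm0 : 0 < m := by
    rw [← hm]
    exact intervalIntegral.intervalIntegral_pos_of_pos_on hI01 hpos one_pos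
  set ε : ℕ → ℝ := fun n => 1 / ((n : ℝ) + 2) with hεdef
  have hε0 : ∀ n, 0 < ε n := fun n => by positivity
  have hε1 : ∀ n, ε n ≤ 1 / 2 := fun n => by
    simp only [hεdef]
    exact one_div_le_one_div_of_le two_pos (by linarith [n.cast_nonneg (α := ℝ)])
  have hεlim : Filter.Tendsto ε Filter.atTop (nhds 0) := by
    have h := (tendsto_one_div_add_atTop_nhds_zero_nat (𝕜 := ℝ)).comp (Filter.tendsto_add_atTop_nat 1)
    refine h.congr fun n => ?_
    simp only [Function.comp, hεdef]
    push_cast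
    ring
  have htlim : Filter.Tendsto (fun n => 1 - ε n) Filter.atTop (nhds 1) := by
    simpa using hεlim.const_sub 1
  set U : ℝ → ℝ := fun x => ∫ s in 0..x, u s with hU
  have hUc : ContinuousOn U (Set.Icc 0 1) := by
    have := intervalIntegral.continuousOn_primitive_interval' hI01 Set.left_mem_uIcc
    rwa [Set.uIcc_of_le zero_le_one] at this
  have hmemε : ∀ n, ε n ∈ Set.Icc (0 : ℝ) 1 := fun n => ⟨(hε0 n).le, by linarith [hε1 n]⟩
  have hmemt : ∀ n, 1 - ε n ∈ Set.Icc (0 : ℝ) 1 := fun n =>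
    ⟨by linarith [hε1 n], by linarith [hε0 n]⟩
  have hUε : Filter.Tendsto (fun n => U (ε n)) Filter.atTop (nhds 0) := by
    have h := (hUc 0 (by simp)).tendsto.comp
      (tendsto_nhdsWithin_iff.2 ⟨hεlim, Filter.Eventually.of_forall hmemε⟩)
    simpa [hU, Function.comp_def] using h
  have hUt : Filter.Tendsto (fun n => U (1 - ε n)) Filter.atTop (nhds m) := by
    have h := (hUc 1 (by simp)).tendsto.comp
      (tendsto_nhdsWithin_iff.2 ⟨htlim, Filter.Eventually.of_forall hmemt⟩)
    rw [← hm]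
    exact h
  set g : ℝ → ℝ := fun s => u s / m - 1 - Real.log (u s / m) with hg
  have hg0 : ∀ s ∈ Set.Ioo (0 : ℝ) 1, 0 ≤ g s := fun s hs => by
    have := Real.log_le_sub_one_of_pos (div_pos (hpos s hs) hm0)
    simp only [hg]
    linarith
  have hcov : AECover (volume.restrict (Set.Ioo (0 : ℝ) 1)) Filter.atTop
      fun n => Set.Ioc (ε n) (1 - ε n) := aecover_Ioo_of_Ioc hεlim htlim
  have hsub : ∀ n, Set.Icc (ε n) (1 - ε n) ⊆ Set.Ioo 0 1 := fun n s hs =>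
    ⟨(hε0 n).trans_le hs.1, by linarith [hs.2, hε0 n]⟩
  have hεt : ∀ n, ε n ≤ 1 - ε n := fun n => by linarith [hε1 n]
  have hlogi : ∀ n, IntervalIntegrable (fun s => Real.log (u s)) volume (ε n) (1 - ε n) := by
    intro n
    refine MonotoneOn.intervalIntegrable ?_
    rw [Set.uIcc_of_le (hεt n)]
    intro y hy z hz hyz
    exact Real.log_le_log (hpos y (hsub n hy)) (hu (hsub n hy) (hsub n hz) hyz)
  have hlog : ∀ s ∈ Set.Ioo (0 : ℝ) 1, g s = u s / m - 1 - Real.log (u s) + Real.log m := by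
    intro s hs
    simp only [hg]
    rw [Real.log_div (hpos s hs).ne' hm0.ne']
    ring
  have huin : ∀ n, IntervalIntegrable u volume (ε n) (1 - ε n) := fun n =>
    intervalIntegrable_of_integrableOn_unit hui (hmemε n) (hmemt n)
  have hgin : ∀ n, IntervalIntegrable g volume (ε n) (1 - ε n) := by
    intro n
    refine ((((huin n).div_const m).sub (intervalIntegrable_const (c := (1 : ℝ)))).sub (hlogi n)).add
      (intervalIntegrable_const (c := Real.log m)) |>.congr fun s hs => ?_
    rw [Set.uIoc_of_le (hεt n)] at hs
    exact (hlog s (hsub n (Set.Ioc_subset_Icc_self hs))).symm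
  have hrestr : ∀ n, (volume.restrict (Set.Ioo (0 : ℝ) 1)).restrict (Set.Ioc (ε n) (1 - ε n))
      = volume.restrict (Set.Ioc (ε n) (1 - ε n)) := fun n =>
    Measure.restrict_restrict_of_subset (Set.Ioc_subset_Icc_self.trans (hsub n))
  set R : ℕ → ℝ := fun n => (U (1 - ε n) - U (ε n)) / m - (1 - ε n - ε n)
    + (1 - ε n - ε n) * Real.log m + (κ * (1 - ε n)
      - (1 - ε n) * Real.log (U (1 - ε n) / (1 - ε n))
      + ε n * (Real.log m - (κ - Q))) with hR
  have hbound : ∀ n, ∫ s in Set.Ioc (ε n) (1 - ε n), g s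
      ∂(volume.restrict (Set.Ioo (0 : ℝ) 1)) ≤ R n := by
    intro n
    have h1 := neg_integral_log_le_of_entropy_le hu hpos hui hul hent (hε0 n) (hεt n)
      (by linarith [hε0 n])
    rw [hm] at h1
    rw [hrestr, setIntegral_congr_fun measurableSet_Ioc
      fun s hs => hlog s (hsub n (Set.Ioc_subset_Icc_self hs)),
      ← intervalIntegral.integral_of_le (hεt n),
      intervalIntegral.integral_add
        ((((huin n).div_const m).sub intervalIntegrable_const).sub (hlogi n))
        intervalIntegrable_const,
      intervalIntegral.integral_sub (((huin n).div_const m).sub intervalIntegrable_const) (hlogi n),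
      intervalIntegral.integral_sub ((huin n).div_const m) intervalIntegrable_const,
      intervalIntegral.integral_div]
    have h2 : ∫ s in (ε n)..(1 - ε n), u s = U (1 - ε n) - U (ε n) :=
      (intervalIntegral.integral_interval_sub_left
        (intervalIntegrable_of_integrableOn_unit hui (by simp) (hmemt n))
        (intervalIntegrable_of_integrableOn_unit hui (by simp) (hmemε n))).symm
    rw [h2]
    simp only [intervalIntegral.integral_const, smul_eq_mul, mul_one, hR]
    linarith
  have hRlim : Filter.Tendsto R Filter.atTop (nhds κ) := by
    have hd : Filter.Tendsto (fun n => 1 - ε n - ε n) Filter.atTop (nhds 1) := by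
      simpa using htlim.sub hεlim
    have hl : Filter.Tendsto (fun n => Real.log (U (1 - ε n) / (1 - ε n))) Filter.atTop
        (nhds (Real.log m)) := by
      have := (hUt.div htlim one_ne_zero).log (by simpa using hm0.ne')
      simpa using this
    have h := ((((hUt.sub hUε).div_const m).sub hd).add (hd.mul_const (Real.log m))).add
      (((htlim.const_mul κ).sub (htlim.mul hl)).add (hεlim.mul_const (Real.log m - (κ - Q))))
    have he : (m - 0) / m - 1 + 1 * Real.log m + (κ * 1 - 1 * Real.log m + 0 * (Real.log m - (κ - Q)))
        = κ := by
      field_simp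
      ring
    rwa [he] at h
  have hint : IntegrableOn g (Set.Ioo 0 1) := by
    refine hcov.integrable_of_integral_bounded_of_nonneg_ae (κ + 1) (fun n => ?_)
      ((ae_restrict_iff' measurableSet_Ioo).2 (Filter.Eventually.of_forall hg0)) ?_
    · rw [IntegrableOn, hrestr]
      exact (hgin n).1
    · filter_upwards [hRlim.eventually (gt_mem_nhds (lt_add_one κ))] with n hn
      exact (hbound n).trans hn.le
  exact ⟨hint, le_of_tendsto_of_tendsto' (hcov.integral_tendsto_of_countably_generated hint) hRlim
    hbound⟩

/-! ### From the rearrangement back to the weight -/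

theorem integral_pos_of_ae_pos {w : ℝ → ℝ} {a b : ℝ} (hab : a < b)
    (hw : IntegrableOn w (Set.Ioc a b)) (hpos : ∀ᵐ x ∂(volume.restrict (Set.Ioc a b)), 0 < w x) :
    0 < ∫ x in a..b, w x := by
  have hwI : IntervalIntegrable w volume a b :=
    (intervalIntegrable_iff_integrableOn_Ioc_of_le hab.le).2 hw
  rw [intervalIntegral.integral_pos_iff_support_of_nonneg_ae' (by
    rw [Set.uIoc_of_le hab.le]
    filter_upwards [hpos] with x hx using hx.le) hwI]
  refine ⟨hab, ?_⟩
  have hsup : volume.restrict (Set.Ioc a b) (Function.support w)ᶜ = 0 :=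
    (ae_iff).1 (hpos.mono fun x hx => (hx.ne' : x ∈ Function.support w))
  rw [← Measure.restrict_apply' measurableSet_Ioc, measure_of_measure_compl_eq_zero hsup]
  simp [hab]

/-- If the entropy of `w` over every subinterval of `[a, b]` is at most `Q`, then
`log ⟨w⟩ - ⟨log w⟩ ≤ e ^ (Q + 1) - (Q + 1)` on `[a, b]`. -/
theorem log_mean_sub_mean_log_le {w : ℝ → ℝ} {a b Q : ℝ} (hab : a < b)
    (hw : IntegrableOn w (Set.Ioc a b)) (hpos : ∀ᵐ x ∂(volume.restrict (Set.Ioc a b)), 0 < w x)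
    (hwl : IntegrableOn (fun x => w x * Real.log (w x)) (Set.Ioc a b))
    (hent : ∀ c d, a ≤ c → c < d → d ≤ b →
      ∫ x in c..d, InformationTheory.klFun (w x / ((∫ y in c..d, w y) / (d - c))) ≤ Q * (d - c)) :
    IntegrableOn (fun x => Real.log (w x)) (Set.Ioc a b) ∧
      Real.log ((∫ x in a..b, w x) / (b - a)) - (∫ x in a..b, Real.log (w x)) / (b - a)
        ≤ Real.exp (Q + 1) - (Q + 1) := by
  have hba : 0 < b - a := sub_pos.2 hab
  have hW : 0 < ∫ x in a..b, w x := integral_pos_of_ae_pos hab hw hpos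
  have hQ : 0 ≤ Q := by
    have h1 := hent a b le_rfl hab le_rfl
    have h2 : 0 ≤ ∫ x in a..b,
        InformationTheory.klFun (w x / ((∫ y in a..b, w y) / (b - a))) := by
      rw [intervalIntegral.integral_of_le hab.le]
      refine integral_nonneg_of_ae ?_
      filter_upwards [hpos] with x hx
      exact InformationTheory.klFun_nonneg (div_nonneg hx.le (div_pos hW hba).le)
    nlinarith
  -- the normalized Lebesgue measure on `[a, b]`
  set μ : Measure ℝ := (ENNReal.ofReal (b - a))⁻¹ • volume.restrict (Set.Ioc a b) with hμ
  have hc0 : ENNReal.ofReal (b - a) ≠ 0 := by simpa using hab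
  have hct : (ENNReal.ofReal (b - a))⁻¹ ≠ ⊤ := ENNReal.inv_ne_top.2 hc0
  have hcr : (ENNReal.ofReal (b - a))⁻¹.toReal = (b - a)⁻¹ := by
    rw [ENNReal.toReal_inv, ENNReal.toReal_ofReal hba.le]
  have hprob : IsProbabilityMeasure μ := ⟨by
    simp only [hμ, Measure.smul_apply, Measure.restrict_apply_univ, Real.volume_Ioc, smul_eq_mul]
    exact ENNReal.inv_mul_cancel hc0 ENNReal.ofReal_ne_top⟩
  have hμi : ∀ {f : ℝ → ℝ}, IntegrableOn f (Set.Ioc a b) → Integrable f μ := fun hf =>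
    hf.smul_measure hct
  have hμint : ∀ f : ℝ → ℝ, ∫ x, f x ∂μ = (b - a)⁻¹ * ∫ x in a..b, f x := fun f => by
    rw [hμ, integral_smul_measure, hcr, intervalIntegral.integral_of_le hab.le, smul_eq_mul]
  have hμset : ∀ {G : Set ℝ}, G ⊆ Set.Ioc a b → ∀ f : ℝ → ℝ,
      ∫ x in G, f x ∂μ = (b - a)⁻¹ * ∫ x in G, f x := fun hG f => by
    rw [hμ, Measure.restrict_smul, integral_smul_measure, hcr,
      Measure.restrict_restrict_of_subset hG, smul_eq_mul]
  have hμreal : ∀ {G : Set ℝ}, G ⊆ Set.Ioc a b → μ.real G = (b - a)⁻¹ * volume.real G := fun hG => by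
    rw [hμ, measureReal_ennreal_smul_apply, hcr, measureReal_restrict_apply' measurableSet_Ioc,
      Set.inter_eq_left.2 hG]
  have hμae : ∀ {p : ℝ → Prop}, (∀ᵐ x ∂(volume.restrict (Set.Ioc a b)), p x) → ∀ᵐ x ∂μ, p x :=
    fun h => Measure.ae_smul_measure h _
  have hwμ := hμi hw
  have hwlμ := hμi hwl
  have hposμ := hμae hpos
  have hwm := hwμ.aemeasurable
  have : IsProbabilityMeasure (Measure.map w μ) := Measure.isProbabilityMeasure_map hwm
  obtain ⟨u, hu, hmap⟩ := exists_monotoneOn_map_eq (Measure.map w μ)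
  have hui : IntegrableOn u (Set.Ioo 0 1) :=
    integrableOn_comp_of_map_eq hwm hu hmap measurable_id hwμ
  have hul : IntegrableOn (fun s => u s * Real.log (u s)) (Set.Ioo 0 1) :=
    integrableOn_comp_of_map_eq hwm hu hmap (g := fun x => x * Real.log x)
      (measurable_id.mul Real.measurable_log) hwlμ
  have hum := aemeasurable_restrict_of_monotoneOn (μ := volume) measurableSet_Ioo hu
  have hupos : ∀ t ∈ Set.Ioo (0 : ℝ) 1, 0 < u t := by
    have h1 : ∀ᵐ y ∂(Measure.map w μ), 0 < y := (ae_map_iff hwm measurableSet_Ioi).2 hposμ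
    rw [← hmap] at h1
    -- Positivity almost everywhere gives a point `s < t` with `u s > 0`, and monotonicity carries
    -- it to `t`.
    have h2 := (ae_map_iff hum measurableSet_Ioi).1 h1
    intro t ht
    have h3 : ∀ᵐ s ∂(volume.restrict (Set.Ioo 0 t)), 0 < u s :=
      ae_restrict_of_ae_restrict_of_subset (Set.Ioo_subset_Ioo_right ht.2.le) h2
    have hne : (ae (volume.restrict (Set.Ioo 0 t))).NeBot := by
      rw [ae_neBot, Ne, Measure.restrict_eq_zero]
      simpa using ht.1
    obtain ⟨s, hs, hs'⟩ := (h3.and (ae_restrict_mem measurableSet_Ioo)).exists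
    exact hs.trans_le (hu ⟨hs'.1, hs'.2.trans ht.2⟩ ht hs'.2.le)
  set m := (∫ x in a..b, w x) / (b - a) with hm
  have hm0 : 0 < m := div_pos hW hba
  have hum1 : ∫ s in 0..1, u s = m := by
    have h := setIntegral_comp_of_map_eq hwm hu hmap measurable_id
    rw [intervalIntegral.integral_of_le zero_le_one, integral_Ioc_eq_integral_Ioo]
    simp only [id] at h
    rw [h, hμint, hm]
    ring
  have huent : ∀ t ∈ Set.Ioo (0 : ℝ) 1,
      ∫ s in 0..t, InformationTheory.klFun (u s / ((∫ y in 0..t, u y) / t)) ≤ Q * t := by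
    intro t ht
    set α := (∫ y in 0..t, u y) / t with hα
    have hα0 : 0 < α := by
      refine div_pos (intervalIntegral.intervalIntegral_pos_of_pos_on
        (intervalIntegrable_of_integrableOn_unit hui (by simp) (Set.Ioo_subset_Icc_self ht))
        (fun s hs => hupos s ⟨hs.1, hs.2.trans ht.2⟩) ht.1) ht.1
    have hαm : α ≤ m := by
      rw [← hum1]
      exact mean_le_mean_of_monotoneOn hu hui ht
    -- The rising sun lemma needs `α ≤ m`, which holds because initial means of a nondecreasing
    -- function do not exceed the full mean.
    obtain ⟨G, hG, hGs, hG1, hG2, hG3⟩ := exists_measurableSet_mean_eq hab hw hwl hα0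
      (by rwa [hm, le_div_iff₀ hba] at hαm) hent
    have hinv : 0 < (b - a)⁻¹ := inv_pos.2 hba
    refine integral_klFun_rearrangement_le hwμ hwlμ hposμ hu hmap ht hα0 hQ
      (by rw [hα, div_mul_cancel₀ _ ht.1.ne']) hG ?_ ?_ ?_
    · rw [hμset hGs, hμreal hGs, hG1]; ring
    · exact hμae ((ae_restrict_iff' measurableSet_Ioc).2 hG2)
    · rw [hμset hGs, hμreal hGs]
      nlinarith
  obtain ⟨hgi, hgle⟩ := integral_sub_log_le_of_entropy_le hu hupos hui hul huent hum1
  set g : ℝ → ℝ := fun x => x / m - 1 - Real.log (x / m) with hg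
  have hgm : Measurable g := by fun_prop
  have hgw : Integrable (fun x => g (w x)) μ := by
    have h : Integrable g (Measure.map u (volume.restrict (Set.Ioo 0 1))) :=
      (integrable_map_measure hgm.aestronglyMeasurable hum).2 hgi
    rw [hmap] at h
    exact (integrable_map_measure hgm.aestronglyMeasurable hwm).1 h
  have hgw' : IntegrableOn (fun x => g (w x)) (Set.Ioc a b) := by
    rwa [hμ, integrable_smul_measure (ENNReal.inv_ne_zero.2 ENNReal.ofReal_ne_top) hct] at hgw
  have hgeq : ∀ᵐ x ∂(volume.restrict (Set.Ioc a b)),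
      w x / m - 1 - g (w x) + Real.log m = Real.log (w x) := by
    filter_upwards [hpos] with x hx
    simp only [hg]
    rw [Real.log_div hx.ne' hm0.ne']
    ring
  have hc1 : ∀ c : ℝ, IntegrableOn (fun _ => c) (Set.Ioc a b) volume :=
    fun c => integrableOn_const (by simp)
  have hwm1 : IntegrableOn (fun x => w x / m - 1) (Set.Ioc a b) :=
    Integrable.sub (Integrable.div_const hw m) (hc1 1)
  have hwmg : IntegrableOn (fun x => w x / m - 1 - g (w x)) (Set.Ioc a b) :=
    Integrable.sub hwm1 hgw'
  have hlogint : IntegrableOn (fun x => Real.log (w x)) (Set.Ioc a b) :=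
    (Integrable.add hwmg (hc1 (Real.log m))).congr hgeq
  refine ⟨hlogint, ?_⟩
  have h1 : ∫ s in Set.Ioo 0 1, (u s / m - 1 - Real.log (u s / m)) = (b - a)⁻¹ * ∫ x in a..b, g (w x) := by
    rw [← hμint, ← setIntegral_comp_of_map_eq hwm hu hmap hgm]
  rw [h1] at hgle
  have h2 : ∫ x in a..b, Real.log (w x)
      = - (∫ x in a..b, g (w x)) + (b - a) * Real.log m := by
    rw [intervalIntegral.integral_of_le hab.le, ← integral_congr_ae hgeq,
      integral_add hwmg (hc1 _), integral_sub hwm1 hgw',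
      integral_sub (Integrable.div_const hw m) (hc1 1), integral_div,
      ← intervalIntegral.integral_of_le hab.le, ← intervalIntegral.integral_of_le hab.le]
    have : (∫ x in a..b, w x) / m = b - a := by
      rw [hm]
      have := hW.ne'
      field_simp
    rw [this]
    simp [hab.le, intervalIntegral.integral_of_le]
  rw [h2]
  have h3 : (-(∫ x in a..b, g (w x)) + (b - a) * Real.log m) / (b - a)
      = Real.log m - (b - a)⁻¹ * ∫ x in a..b, g (w x) := by
    field_simp
    ring
  rw [h3]
  linarith

/-! ### Extended-real means and the upper bound -/

theorem intervalMean_eq {a b : ℝ} (hab : a < b) (w : ℝ → ℝ) :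
    intervalMean w a b = (∫ x in a..b, w x) / (b - a) := by
  rw [intervalMean, setAverage_eq, intervalIntegral.integral_of_le hab.le,
    integral_Icc_eq_integral_Ioc, Real.volume_real_Icc_of_le hab.le, smul_eq_mul]
  ring

theorem extendedMean_eq_of_integrableOn {a b : ℝ} (hab : a < b) {f : ℝ → ℝ}
    (hf : IntegrableOn f (Set.Icc a b)) :
    extendedMean f a b = (((∫ x in a..b, f x) / (b - a) : ℝ) : EReal) := by
  have h1 : ∫⁻ x in Set.Icc a b, ENNReal.ofReal (f x) ≠ ⊤ := hf.lintegral_lt_top.ne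
  have h2 : ∫⁻ x in Set.Icc a b, ENNReal.ofReal (-f x) ≠ ⊤ := hf.neg.lintegral_lt_top.ne
  have hv : volume (Set.Icc a b) ≠ 0 := by simpa using hab
  have hvr : (volume (Set.Icc a b)).toReal = b - a := by
    rw [Real.volume_Icc, ENNReal.toReal_ofReal (by linarith)]
  rw [extendedMean, ← EReal.coe_ennreal_toReal (ENNReal.div_ne_top h1 hv),
    ← EReal.coe_ennreal_toReal (ENNReal.div_ne_top h2 hv), ← EReal.coe_sub, ENNReal.toReal_div,
    ENNReal.toReal_div, hvr, ← sub_div, ← integral_eq_lintegral_pos_part_sub_lintegral_neg_part hf,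
    intervalIntegral.integral_of_le hab.le, integral_Icc_eq_integral_Ioc]

/-- A lower bound keeps the negative part finite, so an infinite positive part would force the
extended mean to be `+∞`. -/
theorem integrableOn_of_extendedMean_le {a b C Q : ℝ} (hab : a < b) {f : ℝ → ℝ}
    (hm : AEStronglyMeasurable f (volume.restrict (Set.Icc a b)))
    (hf : ∀ᵐ x ∂(volume.restrict (Set.Icc a b)), -C ≤ f x)
    (hQ : extendedMean f a b ≤ (Q : EReal)) : IntegrableOn f (Set.Icc a b) := by
  have hv : volume (Set.Icc a b) ≠ 0 := by simpa using hab
  have hvt : volume (Set.Icc a b) ≠ ⊤ := by simp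
  have h2 : ∫⁻ x in Set.Icc a b, ENNReal.ofReal (-f x) ≠ ⊤ := by
    have : ∫⁻ x in Set.Icc a b, ENNReal.ofReal (-f x)
        ≤ ∫⁻ _ in Set.Icc a b, ENNReal.ofReal C := by
      refine lintegral_mono_ae ?_
      filter_upwards [hf] with x hx
      exact ENNReal.ofReal_le_ofReal (by linarith)
    refine (this.trans_lt ?_).ne
    rw [lintegral_const, Measure.restrict_apply_univ]
    exact ENNReal.mul_lt_top ENNReal.ofReal_lt_top hvt.lt_top
  have h1 : ∫⁻ x in Set.Icc a b, ENNReal.ofReal (f x) ≠ ⊤ := by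
    intro htop
    rw [extendedMean, htop, ENNReal.top_div_of_ne_top hvt,
      ← EReal.coe_ennreal_toReal (ENNReal.div_ne_top h2 hv), EReal.coe_ennreal_top,
      EReal.top_sub_coe] at hQ
    exact absurd hQ (not_le.2 (EReal.coe_lt_top Q))
  refine ⟨hm, ?_⟩
  rw [hasFiniteIntegral_iff_norm]
  have : ∫⁻ x in Set.Icc a b, ENNReal.ofReal ‖f x‖
      ≤ ∫⁻ x in Set.Icc a b, (ENNReal.ofReal (f x) + ENNReal.ofReal (-f x)) := by
    refine lintegral_mono fun x => ?_
    rcases le_total 0 (f x) with h | h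
    · rw [Real.norm_of_nonneg h]; exact le_self_add
    · rw [Real.norm_of_nonpos h]; exact le_add_self
  refine this.trans_lt ?_
  rw [lintegral_add_left' hm.aemeasurable.ennreal_ofReal]
  exact ENNReal.add_lt_top.2 ⟨h1.lt_top, h2.lt_top⟩

theorem entropy_le_of_entropyMean_le {w : ℝ → ℝ} {a b Q : ℝ} (hab : a < b)
    (hw : IntegrableOn w (Set.Icc a b)) (hpos : ∀ᵐ x ∂(volume.restrict (Set.Icc a b)), 0 < w x)
    (hQ : entropyMean w a b ≤ (Q : EReal)) :
    IntegrableOn (fun x => w x * Real.log (w x)) (Set.Icc a b) ∧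
      ∫ x in a..b, InformationTheory.klFun (w x / ((∫ y in a..b, w y) / (b - a)))
        ≤ Q * (b - a) := by
  have hba : 0 < b - a := sub_pos.2 hab
  set m := (∫ y in a..b, w y) / (b - a) with hm
  have hW : 0 < ∫ x in a..b, w x := integral_pos_of_ae_pos hab
    (hw.mono_set Set.Ioc_subset_Icc_self)
    (ae_restrict_of_ae_restrict_of_subset Set.Ioc_subset_Icc_self hpos)
  have hm0 : 0 < m := div_pos hW hba
  rw [entropyMean, intervalMean_eq hab, ← hm] at hQ
  have hmeas : AEStronglyMeasurable (fun x => w x / m * Real.log (w x / m))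
      (volume.restrict (Set.Icc a b)) := by
    have := hw.aemeasurable
    exact ((this.div_const m).mul (this.div_const m).log).aestronglyMeasurable
  -- `C = 1` comes from `x log x ≥ x - 1 ≥ -1`, that is, from `klFun ≥ 0`.
  have hfi := integrableOn_of_extendedMean_le (C := 1) hab hmeas (by
    filter_upwards [hpos] with x hx
    have h := InformationTheory.klFun_nonneg (div_pos hx hm0).le
    rw [InformationTheory.klFun] at h
    have := div_pos hx hm0
    linarith) hQ
  rw [extendedMean_eq_of_integrableOn hab hfi, EReal.coe_le_coe_iff, div_le_iff₀ hba] at hQ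
  have hIw : IntervalIntegrable w volume a b :=
    (intervalIntegrable_iff_integrableOn_Icc_of_le hab.le).2 hw
  have hIf : IntervalIntegrable (fun x => w x / m * Real.log (w x / m)) volume a b :=
    (intervalIntegrable_iff_integrableOn_Icc_of_le hab.le).2 hfi
  constructor
  · have h : IntegrableOn (fun x => m * (w x / m * Real.log (w x / m)) + Real.log m * w x)
        (Set.Icc a b) := (hfi.const_mul m).add (hw.const_mul (Real.log m))
    refine h.congr ?_
    filter_upwards [hpos] with x hx
    rw [Real.log_div hx.ne' hm0.ne']
    field_simp
    ring
  · simp only [InformationTheory.klFun]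
    rw [intervalIntegral.integral_sub (hIf.add intervalIntegrable_const) (hIw.div_const m),
      intervalIntegral.integral_add hIf intervalIntegrable_const, intervalIntegral.integral_div]
    have : (∫ x in a..b, w x) / m = b - a := by
      rw [hm]
      have := hW.ne'
      field_simp
    rw [this]
    simp only [intervalIntegral.integral_const, smul_eq_mul, mul_one]
    linarith

theorem meanRatio_eq_of_integrableOn {w : ℝ → ℝ} {a b : ℝ} (hab : a < b)
    (hw : 0 < ∫ x in a..b, w x) (hl : IntegrableOn (fun x => Real.log (w x)) (Set.Icc a b)) :
    meanRatio w a b = ENNReal.ofReal (Real.exp (Real.log ((∫ x in a..b, w x) / (b - a))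
      - (∫ x in a..b, Real.log (w x)) / (b - a))) := by
  have hm0 : 0 < (∫ x in a..b, w x) / (b - a) := div_pos hw (sub_pos.2 hab)
  rw [meanRatio, intervalMean_eq hab, extendedMean_eq_of_integrableOn hab hl, ← EReal.coe_neg,
    EReal.exp_coe, ← ENNReal.ofReal_mul hm0.le, Real.exp_sub,
    Real.exp_log hm0, Real.exp_neg, ← div_eq_mul_inv]

theorem aInftyConst_le_of_rhOneConst_le {I : Set ℝ} {w : ℝ → ℝ} (hw : IsWeightOn I w) {Q : ℝ}
    (hQ : rhOneConst I w ≤ (Q : EReal)) :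
    aInftyConst I w ≤ ENNReal.ofReal (Real.exp (Real.exp (Q + 1) - (Q + 1))) := by
  have hJ : ∀ a b, a < b → Set.Icc a b ⊆ I → entropyMean w a b ≤ (Q : EReal) := by
    intro a b hab hI
    refine le_trans ?_ hQ
    exact le_iSup_of_le a (le_iSup_of_le b (le_iSup_of_le hab (le_iSup_of_le hI le_rfl)))
  refine iSup_le fun a => iSup_le fun b => iSup_le fun hab => iSup_le fun hI => ?_
  have hwi : IntegrableOn w (Set.Icc a b) :=
    hw.locallyIntegrableOn.integrableOn_compact_subset hI isCompact_Icc
  have hpos : ∀ᵐ x ∂(volume.restrict (Set.Icc a b)), 0 < w x :=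
    ae_restrict_of_ae_restrict_of_subset hI hw.pos_ae
  have hposc : ∀ᵐ x ∂(volume.restrict (Set.Ioc a b)), 0 < w x :=
    ae_restrict_of_ae_restrict_of_subset Set.Ioc_subset_Icc_self hpos
  have hent : ∀ c d, a ≤ c → c < d → d ≤ b →
      ∫ x in c..d, InformationTheory.klFun (w x / ((∫ y in c..d, w y) / (d - c))) ≤ Q * (d - c) := by
    intro c d hac hcd hdb
    have hs : Set.Icc c d ⊆ Set.Icc a b := Set.Icc_subset_Icc hac hdb
    exact (entropy_le_of_entropyMean_le hcd (hwi.mono_set hs)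
      (ae_restrict_of_ae_restrict_of_subset hs hpos) (hJ c d hcd (hs.trans hI))).2
  obtain ⟨hl, hle⟩ := log_mean_sub_mean_log_le hab (hwi.mono_set Set.Ioc_subset_Icc_self) hposc
    ((entropy_le_of_entropyMean_le hab hwi hpos (hJ a b hab hI)).1.mono_set
      Set.Ioc_subset_Icc_self) hent
  rw [meanRatio_eq_of_integrableOn hab
    (integral_pos_of_ae_pos hab (hwi.mono_set Set.Ioc_subset_Icc_self) hposc)
    ((integrableOn_Icc_iff_integrableOn_Ioc).2 hl)]
  exact ENNReal.ofReal_le_ofReal (Real.exp_le_exp.2 hle)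

/-! ### Power weights -/

section PowerWeight

variable {v : ℝ}

theorem continuous_power_weight (hv : 1 ≤ v) : Continuous fun t : ℝ => v * t ^ (v - 1) :=
  continuous_const.mul (Real.continuous_rpow_const (by linarith))

theorem integral_power_weight (hv : 1 ≤ v) (a b : ℝ) :
    ∫ t in a..b, v * t ^ (v - 1) = b ^ v - a ^ v := by
  rw [intervalIntegral.integral_const_mul, integral_rpow (Or.inl (by linarith)), sub_add_cancel]
  field_simp

/-- The antiderivative is built from `y log y` at `y = t ^ v`, so it is continuous up to `t = 0` and
is differentiated only in the open interval. -/
theorem integral_power_weight_mul_log (hv : 1 ≤ v) {a b : ℝ} (ha : 0 ≤ a) (hab : a ≤ b) :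
    ∫ t in a..b, v * t ^ (v - 1) * Real.log (v * t ^ (v - 1))
      = (Real.log v - (v - 1) / v) * (b ^ v - a ^ v)
        + (v - 1) * (b ^ v * Real.log b - a ^ v * Real.log a) := by
  have hv0 : 0 < v := by linarith
  have hcont : Continuous fun t : ℝ => t ^ v := Real.continuous_rpow_const hv0.le
  have hlog : ∀ t : ℝ, 0 ≤ t → t ^ v * Real.log (t ^ v) = v * (t ^ v * Real.log t) := by
    intro t ht
    rcases eq_or_lt_of_le ht with rfl | ht
    · simp [Real.zero_rpow hv0.ne']
    · rw [Real.log_rpow ht]; ring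
  have h := intervalIntegral.integral_eq_sub_of_hasDerivAt_of_le hab
    (f := fun t => (Real.log v - (v - 1) / v) * t ^ v + (v - 1) / v * (t ^ v * Real.log (t ^ v)))
    (f' := fun t => v * t ^ (v - 1) * Real.log (v * t ^ (v - 1)))
    ((continuous_const.mul hcont).add
      (continuous_const.mul (Real.continuous_mul_log.comp hcont))).continuousOn ?_
    ((Real.continuous_mul_log.comp (continuous_power_weight hv)).intervalIntegrable a b)
  · rw [h, hlog a ha, hlog b (ha.trans hab)]
    field_simp
    ring
  · intro t ht
    have ht0 : 0 < t := ha.trans_lt ht.1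
    have d1 : HasDerivAt (fun t : ℝ => t ^ v) (v * t ^ (v - 1)) t :=
      Real.hasDerivAt_rpow_const (Or.inl ht0.ne')
    have hp : 0 < t ^ v := Real.rpow_pos_of_pos ht0 v
    have hp' : 0 < t ^ (v - 1) := Real.rpow_pos_of_pos ht0 _
    have d2 := (d1.const_mul (Real.log v - (v - 1) / v)).add
      ((d1.fun_mul (d1.log hp.ne')).const_mul ((v - 1) / v))
    refine d2.congr_deriv ?_
    rw [Real.log_mul hv0.ne' hp'.ne', Real.log_rpow ht0, Real.log_rpow ht0]
    field_simp
    ring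

theorem entropyMean_power_weight (hv : 1 ≤ v) {a b : ℝ} (ha : 0 ≤ a) (hab : a < b) :
    entropyMean (fun t => v * t ^ (v - 1)) a b =
      ((Real.log v - (v - 1) / v + (v - 1) * (b ^ v * Real.log b - a ^ v * Real.log a)
        / (b ^ v - a ^ v) - Real.log ((b ^ v - a ^ v) / (b - a)) : ℝ) : EReal) := by
  have hba : 0 < b - a := sub_pos.2 hab
  have hP : 0 < b ^ v - a ^ v := sub_pos.2 (Real.rpow_lt_rpow ha hab (by linarith))
  have hw := continuous_power_weight hv
  rw [entropyMean, intervalMean_eq hab, integral_power_weight hv]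
  set m := (b ^ v - a ^ v) / (b - a) with hm
  have hm0 : 0 < m := div_pos hP hba
  rw [extendedMean_eq_of_integrableOn hab]
  · have heq : ∀ x : ℝ, v * x ^ (v - 1) / m * Real.log (v * x ^ (v - 1) / m)
        = (v * x ^ (v - 1) * Real.log (v * x ^ (v - 1)) - v * x ^ (v - 1) * Real.log m) / m := by
      intro x
      rcases eq_or_ne (v * x ^ (v - 1)) 0 with h | h
      · simp [h]
      · rw [Real.log_div h hm0.ne']; ring
    simp only [heq]
    have hi : IntervalIntegrable (fun t => v * t ^ (v - 1) * Real.log (v * t ^ (v - 1))) volume a b :=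
      (Real.continuous_mul_log.comp hw).intervalIntegrable a b
    rw [intervalIntegral.integral_div, intervalIntegral.integral_sub hi
      ((hw.intervalIntegrable a b).mul_const _), intervalIntegral.integral_mul_const,
      integral_power_weight hv, integral_power_weight_mul_log hv ha hab.le]
    congr 1
    set l := Real.log m
    have hmm : m * (b - a) = b ^ v - a ^ v := by rw [hm]; field_simp
    rw [div_div, hmm]
    field_simp
  · exact (Real.continuous_mul_log.comp (hw.div_const m)).continuousOn.integrableOn_Icc

/-- This says that the entropy over `[a, b]` is at most that over `[0, b]`. Dividing the mean by the
endpoint value `b ^ (v - 1)` reduces it to `log y ≥ 1 - 1/y` and `e^x ≥ 1 + x`. -/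
theorem power_weight_log_mean_bound (hv : 1 ≤ v) {a b : ℝ} (ha : 0 < a) (hab : a < b) :
    (v - 1) * (b ^ v * Real.log b - a ^ v * Real.log a) / (b ^ v - a ^ v)
      ≤ Real.log ((b ^ v - a ^ v) / (b - a)) := by
  have hb : 0 < b := ha.trans hab
  have hba : 0 < b - a := sub_pos.2 hab
  have hP : 0 < b ^ v - a ^ v := sub_pos.2 (Real.rpow_lt_rpow ha.le hab (by linarith))
  have hA : 0 < a ^ v := Real.rpow_pos_of_pos ha v
  have hB : b ^ v = b ^ (v - 1) * b := by rw [← Real.rpow_add_one hb.ne', sub_add_cancel]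
  have hA' : a ^ v = a ^ (v - 1) * a := by rw [← Real.rpow_add_one ha.ne', sub_add_cancel]
  have hp : 0 < b ^ (v - 1) := Real.rpow_pos_of_pos hb _
  have hq : 0 < a ^ (v - 1) := Real.rpow_pos_of_pos ha _
  -- `a ^ v (1 + log ((b / a) ^ (v - 1))) ≤ a b ^ (v - 1)`
  have h1 : a ^ v * (1 + (v - 1) * (Real.log b - Real.log a)) ≤ a * b ^ (v - 1) := by
    have h := Real.add_one_le_exp ((v - 1) * (Real.log b - Real.log a))
    have he : Real.exp ((v - 1) * (Real.log b - Real.log a)) = b ^ (v - 1) / a ^ (v - 1) := by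
      rw [Real.rpow_def_of_pos hb, Real.rpow_def_of_pos ha, ← Real.exp_sub]
      ring_nf
    rw [he] at h
    calc a ^ v * (1 + (v - 1) * (Real.log b - Real.log a))
        ≤ a ^ v * (b ^ (v - 1) / a ^ (v - 1)) := mul_le_mul_of_nonneg_left (by linarith) hA.le
      _ = a * b ^ (v - 1) := by rw [hA']; field_simp
  have h2 := Real.one_sub_inv_le_log_of_pos
    (x := (b ^ v - a ^ v) / (b - a) / b ^ (v - 1)) (by positivity)
  rw [Real.log_div (div_pos hP hba).ne' hp.ne', Real.log_rpow hb] at h2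
  have h3 : (v - 1) * (b ^ v * Real.log b - a ^ v * Real.log a) / (b ^ v - a ^ v)
      = (v - 1) * Real.log b
        + a ^ v * ((v - 1) * (Real.log b - Real.log a)) / (b ^ v - a ^ v) := by
    field_simp
    ring
  have h4 : 1 - ((b ^ v - a ^ v) / (b - a) / b ^ (v - 1))⁻¹
      = (a * b ^ (v - 1) - a ^ v) / (b ^ v - a ^ v) := by
    rw [inv_div, eq_div_iff hP.ne', div_div_eq_mul_div, sub_mul, div_mul_cancel₀ _ hP.ne', hB]
    ring
  have h5 : a ^ v * ((v - 1) * (Real.log b - Real.log a)) / (b ^ v - a ^ v)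
      ≤ (a * b ^ (v - 1) - a ^ v) / (b ^ v - a ^ v) :=
    div_le_div_of_nonneg_right (by linarith) hP.le
  rw [h3]
  linarith

theorem log_rpow_div_self {b : ℝ} (hb : 0 < b) :
    Real.log (b ^ v / b) = (v - 1) * Real.log b := by
  rw [Real.log_div (Real.rpow_pos_of_pos hb v).ne' hb.ne', Real.log_rpow hb]
  ring

theorem entropyMean_power_weight_zero (hv : 1 ≤ v) {b : ℝ} (hb : 0 < b) :
    entropyMean (fun t => v * t ^ (v - 1)) 0 b = ((Real.log v - (v - 1) / v : ℝ) : EReal) := by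
  rw [entropyMean_power_weight hv le_rfl hb]
  congr 1
  have hp := Real.rpow_pos_of_pos hb v
  rw [Real.zero_rpow (by linarith), zero_mul, sub_zero, sub_zero, sub_zero, log_rpow_div_self hb]
  field_simp
  ring

theorem isWeightOn_power_weight (hv : 1 ≤ v) :
    IsWeightOn (Set.Ici 0) fun t => v * t ^ (v - 1) where
  locallyIntegrableOn :=
    (continuous_power_weight hv).locallyIntegrable.locallyIntegrableOn _
  pos_ae := by
    rw [ae_restrict_iff' measurableSet_Ici]
    filter_upwards [Measure.ae_ne volume 0] with x hx hx'
    have : 0 < x := lt_of_le_of_ne hx' (Ne.symm hx)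
    positivity

theorem rhOneConst_power_weight (hv : 1 ≤ v) :
    rhOneConst (Set.Ici 0) (fun t => v * t ^ (v - 1)) = ((Real.log v - (v - 1) / v : ℝ) : EReal) := by
  refine le_antisymm ?_ ?_
  · refine iSup_le fun a => iSup_le fun b => iSup_le fun hab => iSup_le fun hI => ?_
    have ha : 0 ≤ a := hI (Set.left_mem_Icc.2 hab.le)
    rcases eq_or_lt_of_le ha with rfl | ha
    · exact (entropyMean_power_weight_zero hv hab).le
    · rw [entropyMean_power_weight hv ha.le hab, EReal.coe_le_coe_iff]
      linarith [power_weight_log_mean_bound hv ha hab]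
  · rw [← entropyMean_power_weight_zero hv one_pos]
    exact le_iSup_of_le 0 (le_iSup_of_le 1 (le_iSup_of_le one_pos
      (le_iSup_of_le Set.Icc_subset_Ici_self le_rfl)))

theorem meanRatio_power_weight_zero (hv : 1 ≤ v) {b : ℝ} (hb : 0 < b) :
    meanRatio (fun t => v * t ^ (v - 1)) 0 b = ENNReal.ofReal (Real.exp (v - 1 - Real.log v)) := by
  have hv0 : 0 < v := by linarith
  have hI : ∫ t in (0 : ℝ)..b, v * t ^ (v - 1) = b ^ v := by
    rw [integral_power_weight hv, Real.zero_rpow hv0.ne', sub_zero]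
  have hlog : ∀ t ∈ Set.Ioc 0 b,
      Real.log v + (v - 1) * Real.log t = Real.log (v * t ^ (v - 1)) := by
    intro t ht
    rw [Real.log_mul hv0.ne' (Real.rpow_pos_of_pos ht.1 _).ne', Real.log_rpow ht.1]
  have hli : IntervalIntegrable (fun t => (v - 1) * Real.log t) volume 0 b :=
    intervalIntegral.intervalIntegrable_log'.const_mul _
  have hi : IntegrableOn (fun t => Real.log v + (v - 1) * Real.log t) (Set.Ioc 0 b) :=
    (intervalIntegrable_iff_integrableOn_Ioc_of_le hb.le).1 (intervalIntegrable_const.add hli)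
  rw [meanRatio_eq_of_integrableOn hb (by rw [hI]; exact Real.rpow_pos_of_pos hb v)
    ((integrableOn_Icc_iff_integrableOn_Ioc).2 (hi.congr_fun hlog measurableSet_Ioc)), hI, sub_zero,
    log_rpow_div_self hb, intervalIntegral.integral_of_le hb.le,
    ← setIntegral_congr_fun measurableSet_Ioc hlog, ← intervalIntegral.integral_of_le hb.le,
    intervalIntegral.integral_add intervalIntegrable_const hli,
    intervalIntegral.integral_const_mul, integral_log]
  congr 2
  simp
  field_simp
  ring

end PowerWeight

/-! ### The smallest root and the conclusion -/

theorem exists_isLeast_sub_log_eq {Q : ℝ} (hQ : 0 ≤ Q) :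
    ∃ γ ≤ 1, IsLeast {t : ℝ | 0 < t ∧ t - Real.log t = Q + 1} γ := by
  set x := Real.exp (-(Q + 1)) with hx
  have hx0 : 0 < x := Real.exp_pos _
  have hx1 : x ≤ 1 := Real.exp_le_one_iff.2 (by linarith)
  have hc : ContinuousOn (fun t : ℝ => t - Real.log t) (Set.Icc x 1) :=
    continuousOn_id.sub (continuousOn_id.log fun t ht => (hx0.trans_le ht.1).ne')
  have hmem : Q + 1 ∈ Set.Icc ((1 : ℝ) - Real.log 1) (x - Real.log x) := by
    rw [Real.log_one, hx, Real.log_exp]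
    constructor <;> linarith
  obtain ⟨γ, hγ, hγeq⟩ := intermediate_value_Icc' hx1 hc hmem
  have hγ0 : 0 < γ := hx0.trans_le hγ.1
  refine ⟨γ, hγ.2, ⟨hγ0, hγeq⟩, ?_⟩
  rintro t ⟨ht, hteq⟩
  -- Here `t < γ ≤ 1`, and `t - log t` is strictly decreasing on `(0, 1]`.
  by_contra! hlt
  have h1 := Real.log_lt_sub_one_of_pos (div_pos ht hγ0) (by
    rw [Ne, div_eq_one_iff_eq hγ0.ne']; exact hlt.ne)
  rw [Real.log_div ht.ne' hγ0.ne'] at h1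
  have h2 : γ - t ≤ 1 - t / γ := by
    rw [one_sub_div hγ0.ne', le_div_iff₀ hγ0]
    nlinarith [hγ.2]
  simp only at hγeq
  linarith

/-- The equation gives `1/γ = e^{Q+1} e^{-γ} ≥ e^{Q+1} (1 - γ) = e^{Q+1} - e^γ`, and `γ ≤ 1` bounds
the loss by `e`; this is the source of the constant `e^{-e}`. -/
theorem exp_bound_of_sub_log_eq {γ Q : ℝ} (hγ0 : 0 < γ) (hγ1 : γ ≤ 1)
    (hγ : γ - Real.log γ = Q + 1) :
    Real.exp (-Real.exp 1) * (Real.exp (Real.exp (Q + 1) - 1) / Real.exp (Q + 1))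
      ≤ Real.exp (1 / γ - 1 - Real.log (1 / γ)) := by
  rw [← Real.exp_sub, ← Real.exp_add, Real.exp_le_exp, one_div, Real.log_inv]
  have h1 : γ⁻¹ = Real.exp (Q + 1) * Real.exp (-γ) := by
    rw [← Real.exp_add, ← hγ, show γ - Real.log γ + -γ = -Real.log γ by ring, Real.exp_neg,
      Real.exp_log hγ0]
  have h2 : γ * Real.exp (Q + 1) = Real.exp γ := by
    rw [← hγ, Real.exp_sub, Real.exp_log hγ0]
    field_simp
  have h3 : Real.exp γ ≤ Real.exp 1 := Real.exp_le_exp.2 hγ1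
  have h4 := mul_le_mul_of_nonneg_left (Real.add_one_le_exp (-γ)) (Real.exp_pos (Q + 1)).le
  nlinarith

theorem theorem1p2 :
    (∃ C : ℝ, 0 < C ∧
      ∀ (I : Set ℝ), I.OrdConnected → ∀ (w : ℝ → ℝ), IsWeightOn I w →
        ∀ (Q : ℝ), rhOneConst I w = (Q : EReal) →
          aInftyConst I w ≤
            ENNReal.ofReal (C * (Real.exp (Real.exp (Q + 1) - 1) / Real.exp (Q + 1)))) ∧
    (∃ c : ℝ, 0 < c ∧
      ∀ (Q : ℝ), 0 ≤ Q →
        ∃ γ : ℝ, IsLeast {t : ℝ | 0 < t ∧ t - Real.log t = Q + 1} γ ∧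
          IsWeightOn (Set.Ici 0) (extremalWeight γ) ∧
          rhOneConst (Set.Ici 0) (extremalWeight γ) = (Q : EReal) ∧
          (∀ b : ℝ, 0 < b →
            meanRatio (extremalWeight γ) 0 b = ENNReal.ofReal (γ * Real.exp ((1 - γ) / γ))) ∧
          ENNReal.ofReal (c * (Real.exp (Real.exp (Q + 1) - 1) / Real.exp (Q + 1))) ≤
            aInftyConst (Set.Ici 0) (extremalWeight γ)) := by
  -- `C = e` compensates the `-1` in the exponent `e^{Q+1} - 1`.
  refine ⟨⟨Real.exp 1, Real.exp_pos 1, fun I _ w hw Q hQ => ?_⟩,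
    ⟨Real.exp (-Real.exp 1), Real.exp_pos _, fun Q hQ => ?_⟩⟩
  · refine (aInftyConst_le_of_rhOneConst_le hw hQ.le).trans (le_of_eq ?_)
    rw [← Real.exp_sub, ← Real.exp_add]
    ring_nf
  · obtain ⟨γ, hγ1, hγ⟩ := exists_isLeast_sub_log_eq hQ
    obtain ⟨hγ0, hγeq⟩ := hγ.1
    have hv : 1 ≤ 1 / γ := by rwa [le_div_iff₀ hγ0, one_mul]
    have hexp : (1 - γ) / γ = 1 / γ - 1 := by field_simp
    have hw : extremalWeight γ = fun t => 1 / γ * t ^ (1 / γ - 1) := by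
      funext t
      rw [extremalWeight, hexp]
    have hlog : Real.log (1 / γ) = -Real.log γ := by rw [one_div, Real.log_inv]
    have hratio : ∀ b : ℝ, 0 < b → meanRatio (extremalWeight γ) 0 b
        = ENNReal.ofReal (Real.exp (1 / γ - 1 - Real.log (1 / γ))) := fun b hb => by
      rw [hw]
      exact meanRatio_power_weight_zero hv hb
    refine ⟨γ, hγ, ?_, ?_, ?_, ?_⟩
    · rw [hw]
      exact isWeightOn_power_weight hv
    · rw [hw, rhOneConst_power_weight hv]
      congr 1
      rw [hlog]
      field_simp
      linarith
    · intro b hb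
      rw [hratio b hb, hexp, Real.exp_sub, hlog, Real.exp_neg, Real.exp_log hγ0]
      congr 1
      field_simp
    · refine le_trans ?_ (le_iSup_of_le 0 (le_iSup_of_le 1 (le_iSup_of_le one_pos
        (le_iSup_of_le Set.Icc_subset_Ici_self le_rfl))))
      rw [hratio 1 one_pos]
      exact ENNReal.ofReal_le_ofReal (exp_bound_of_sub_log_eq hγ0 hγ1 hγeq)
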